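/- Let $(G_n)$ be a sequence of finite simple graphs with $|V(G_n)|\to\infty$, and let $p\in[0,1]$. The sequence is called $p$-quasi-random if for every $s$ and every graph $F$ on $s$ vertices the number of labelled (not necessarily induced) copies of $F$ in $G_n$, i.e. of injective homomorphisms $F\to G_n$, is $(p^{|E(F)|}+o(1))\,|V(G_n)|^s$. Put $\psi_n(z)=x^{-N}\phi_{G_n}(x)\big|_{x=N/z}$ for $z\ne0$ and $\psi_n(0)=1$, where $N=|V(G_n)|$ and $\phi_{G_n}$ is the characteristic polynomial of the adjacency matrix of $G_n$. For a graphon $\mathcal G$ (a measurable symmetric function $[0,1]^2\to[0,1]$), let $$\psi_{\mathcal G}(z)=\exp\Big(z^2\,\tfrac{\|\mathcal G\|_2^2-\|\mathcal G\|_1}{2}\Big)\prod_j(1-\lambda_jz)e^{\lambda_jz},$$ where $\lambda_j$ runs over the eigenvalues, with multiplicity, of the kernel operator of $\mathcal G$ on $L^2([0,1])$. We write $G_n\to\mathcal G$ if the homomorphism density of every finite simple graph in $G_n$ converges to its homomorphism density in $\mathcal G$. For a partition $\lambda$ in which the part $b$ occurs $m_b$ times, let $\eta(\lambda)=\prod_b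 b^{m_b}m_b!$, and let $$f_p(z)=\sum_{k=0}^\infty z^k\sum_{\lambda}\frac{(-1)^{j}p^{k-i}}{\eta(\lambda)},$$ where the inner sum is over the integer partitions $\lambda$ of $k$ into parts of size at least $2$, $j$ is the number of parts of $\lambda$, and $i$ is the number of parts of size exactly $2$. Then the series $f_p(z)$ converges for every $z\in\mathbb C$, and $$f_p(z)=(1-pz)\exp\Big(pz-\frac{p(1-p)}2z^2\Big).$$ Moreover, $(G_n)$ is $p$-quasi-random if and only if its characteristic power series is $f_p$, in each of the following senses: 1. $(G_n)$ is $p$-quasi-random if and only if $\lim_{n\to\infty}\psi_n(z)=f_p(z)$ for every $z\in\mathbb C$. 2. $(G_n)$ is $p$-quasi-random if and only if $G_n\to\mathcal G$ for some graphon $\mathcal G$ with $\psi_{\mathcal G}(z)=f_p(z)$ for every $z\in\mathbb C$. 3. If $G_n\to\mathcal G$, then $(G_n)$ is $p$-quasi-random if and only if $\psi_{\mathcal G}(z)=f_p(z)$ for every $z\in\mathbb C$. -/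

import Mathlib

open Filter Topology MeasureTheory
open scoped unitInterval Nat

noncomputable section

/-! ### Finite graphs -/

/-- The number of labelled, not necessarily induced, copies of `F` in `G` (injective homomorphisms
from `F` to `G`), divided by `|V(G)| ^ |V(F)|`. -/
def copyDensity {V : Type*} [Fintype V] {s : ℕ} (F : SimpleGraph (Fin s)) (G : SimpleGraph V) : ℝ :=
  (G.labelledCopyCount F : ℝ) / (Fintype.card V : ℝ) ^ s

/-- The homomorphism density `t(F, G)`. -/
def homDensity {V : Type*} [Fintype V] {s : ℕ} (F : SimpleGraph (Fin s)) (G : SimpleGraph V) : ℝ :=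
  (Nat.card (F →g G) : ℝ) / (Fintype.card V : ℝ) ^ s

/-- A sequence of graphs is `p`-quasi-random if, for every `s` and every graph `F` on `s` vertices,
the number of labelled copies of `F` in `G n` is `(p ^ |E(F)| + o(1)) * |V(G n)| ^ s`. -/
def IsQuasiRandom {V : ℕ → Type*} [∀ n, Fintype (V n)] (G : ∀ n, SimpleGraph (V n)) (p : ℝ) :
    Prop :=
  ∀ (s : ℕ) (F : SimpleGraph (Fin s)),
    Tendsto (fun n => copyDensity F (G n)) atTop (𝓝 (p ^ F.edgeSet.ncard))

open Classical in
/-- The normalized reciprocal characteristic polynomial `ψ_G(z)`: the value of `x ^ (-n) * φ_G(x)`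
at `x = n / z` when `z ≠ 0`, and `1` at `z = 0`, where `n = |V(G)|` and `φ_G` is the characteristic
polynomial of the adjacency matrix. -/
def graphPsi {V : Type*} [Fintype V] (G : SimpleGraph V) (z : ℂ) : ℂ :=
  if z = 0 then 1
  else (((Fintype.card V : ℂ) / z) ^ Fintype.card V)⁻¹ *
    (G.adjMatrix ℂ).charpoly.eval ((Fintype.card V : ℂ) / z)

/-! ### Graphons -/

/-- A graphon: a measurable symmetric function `[0,1] × [0,1] → [0,1]`
(a representative of its class). -/
structure Graphon where
  /-- the kernel -/
  kernel : I → I → ℝ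
  measurable_kernel : Measurable (Function.uncurry kernel)
  kernel_symm : ∀ x y, kernel x y = kernel y x
  kernel_mem : ∀ x y, kernel x y ∈ Set.Icc (0 : ℝ) 1

namespace Graphon

open Classical in
/-- The homomorphism density `t(F, W)`: the integral over `[0,1] ^ s` of the product of
`W (x i) (x j)` over the edges `{i, j}` of `F`. -/
def homDensity {s : ℕ} (F : SimpleGraph (Fin s)) (W : Graphon) : ℝ :=
  ∫ x : Fin s → I, ∏ e : Fin s × Fin s with e.1 < e.2 ∧ F.Adj e.1 e.2, W.kernel (x e.1) (x e.2)

lemma integrable_kernel_mul (W : Graphon) (f : Lp ℝ 2 (volume : Measure I)) (x : I) :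
    Integrable (fun y => W.kernel x y * f y) := by
  have hf : Integrable (f : I → ℝ) := (Lp.memLp f).integrable (by norm_num)
  refine hf.bdd_mul (c := 1)
    (W.measurable_kernel.comp measurable_prodMk_left).aestronglyMeasurable (ae_of_all _ fun y => ?_)
  have h := W.kernel_mem x y
  show ‖W.kernel x y‖ ≤ 1
  rw [Real.norm_eq_abs, abs_of_nonneg h.1]
  exact h.2

lemma memLp_kernelIntegral (W : Graphon) (f : Lp ℝ 2 (volume : Measure I)) :
    MemLp (fun x => ∫ y, W.kernel x y * f y) 2 (volume : Measure I) := by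
  have hf : Integrable (f : I → ℝ) := (Lp.memLp f).integrable (by norm_num)
  refine MemLp.of_bound ?_ (∫ y, ‖f y‖) (ae_of_all _ fun x => ?_)
  · refine StronglyMeasurable.aestronglyMeasurable ?_
    refine StronglyMeasurable.integral_prod_right (f := fun x y => W.kernel x y * f y) ?_
    exact W.measurable_kernel.stronglyMeasurable.mul
      ((Lp.stronglyMeasurable f).comp_measurable measurable_snd)
  · refine norm_integral_le_of_norm_le hf.norm (ae_of_all _ fun y => ?_)
    have h := W.kernel_mem x y
    rw [norm_mul, Real.norm_eq_abs (W.kernel x y), abs_of_nonneg h.1]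
    exact mul_le_of_le_one_left (norm_nonneg _) h.2

/-- The self-adjoint kernel operator `f ↦ ∫ y, W(x, y) f(y)` of a graphon, on real `L²([0,1])`. -/
def kernelOp (W : Graphon) : Lp ℝ 2 (volume : Measure I) →ₗ[ℝ] Lp ℝ 2 (volume : Measure I) where
  toFun f := (W.memLp_kernelIntegral f).toLp _
  map_add' f g := by
    rw [← MemLp.toLp_add]
    refine MemLp.toLp_congr _ _ (ae_of_all _ fun x => ?_)
    simp only [Pi.add_apply]
    rw [← integral_add (W.integrable_kernel_mul f x) (W.integrable_kernel_mul g x)]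
    refine integral_congr_ae ?_
    filter_upwards [Lp.coeFn_add f g] with y hy
    rw [hy, Pi.add_apply, mul_add]
  map_smul' c f := by
    rw [RingHom.id_apply, ← MemLp.toLp_const_smul]
    refine MemLp.toLp_congr _ _ (ae_of_all _ fun x => ?_)
    simp only [Pi.smul_apply, smul_eq_mul]
    rw [← integral_const_mul]
    refine integral_congr_ae ?_
    filter_upwards [Lp.coeFn_smul c f] with y hy
    rw [hy, Pi.smul_apply, smul_eq_mul]
    ring

/-- The multiplicity of the real number `l` as an eigenvalue of the kernel operator. -/
def eigMult (W : Graphon) (l : ℝ) : ℕ :=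
  Module.finrank ℝ (Module.End.eigenspace W.kernelOp l)

/-- The regularized (Hilbert–Carleman) determinant `det⁽²⁾(I - z W)`: the product of
`(1 - l z) exp(l z)` over the eigenvalues `l` of the kernel operator, with multiplicity. Numbers
`l` which are not eigenvalues, and `l = 0`, contribute a factor `1`. -/
def det2 (W : Graphon) (z : ℂ) : ℂ :=
  ∏' l : ℝ, ((1 - (l : ℂ) * z) * Complex.exp ((l : ℂ) * z)) ^ W.eigMult l

/-- The characteristic power series
`ψ_W(z) = det⁽²⁾(I - z W) exp(z² (‖W‖₂² - ‖W‖₁) / 2)` of a graphon. -/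
def charPowerSeries (W : Graphon) (z : ℂ) : ℂ :=
  W.det2 z * Complex.exp (z ^ 2 *
    (((∫ q : I × I, |W.kernel q.1 q.2| ^ 2) - ∫ q : I × I, |W.kernel q.1 q.2| : ℝ) : ℂ) / 2)

end Graphon

/-- The graphs `G n` converge to the graphon `W`: all homomorphism densities converge. -/
def LeftConverges {V : ℕ → Type*} [∀ n, Fintype (V n)] (G : ∀ n, SimpleGraph (V n))
    (W : Graphon) : Prop :=
  ∀ (s : ℕ) (F : SimpleGraph (Fin s)),
    Tendsto (fun n => homDensity F (G n)) atTop (𝓝 (W.homDensity F))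

/-! ### The coefficients -/

/-- `η(λ) = ∏ b ^ m_b * m_b !` over the distinct parts `b` of `λ`, where `m_b` is the multiplicity
of `b`. -/
def partEta {k : ℕ} (l : Nat.Partition k) : ℕ :=
  ∏ b ∈ l.parts.toFinset, b ^ l.parts.count b * (l.parts.count b)!

/-- The sum of `(-1) ^ j * p ^ (k - i) / η(λ)` over the partitions `λ` of `k` into parts of size at
least `2`, where `j` is the number of parts of `λ` and `i` the number of parts equal to `2`. -/
def quasiCoeff (p : ℝ) (k : ℕ) : ℝ :=
  ∑ l : Nat.Partition k with ∀ b ∈ l.parts, 2 ≤ b,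
    (-1) ^ l.parts.card * p ^ (k - l.parts.count 2) / (partEta l : ℝ)

end

/-!
Everything reduces to two densities. For a graph with normalized eigenvalues `μ i` (those of the
adjacency matrix divided by the number of vertices), `ψ(z) = ∏ (1 - μ i z)` with `∑ μ i = 0`,
`∑ μ i ^ 2 = t(K₂)` and `∑ μ i ^ 4 = t(C₄)`; for a graphon, the kernel operator is Hilbert–Schmidt,
`∑ μ i ^ 2 = ‖W‖₂²` and `∑ μ i ^ 4 = t(C₄, W)`. In both settings `ψ` is the closed form `quasiPsi p`
(in the limit, for a sequence of graphs) if and only if `t(K₂) = p` and `t(C₄) = p ^ 4`.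

* Given the densities, the largest eigenvalue is at least `t(K₂) = p`, an average of the
  eigenvalues, while its fourth power is at most `t(C₄) = p ^ 4`. So one eigenvalue is `p` and the
  fourth powers of the others add up to `0`; these others contribute to `ψ` only through their sum
  and their sum of squares (`tendsto_graphPsi_of_tendsto_densities`,
  `Graphon.charPowerSeries_eq_quasiPsi`).
* Given `ψ`, the product `ψ(i√u) ψ(-i√u)` is a product of factors `1 + μ i ^ 2 u` times an
  exponential, and its logarithm is `t(K₂) u - t(C₄) u ^ 2 / 2 + O(u ^ 3)`, with an absolute constant
  in the error term (`exists_log_mul_of_hasProd`). Both densities can be read off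
  (`tendsto_coeffs_of_tendsto_mul`).

By the theorem of Chung, Graham and Wilson, the two densities characterize quasi-randomness
(`isQuasiRandom_iff_tendsto_densities`): the `C₄`-density controls the sums of `w - p` over all
rectangles, and the edges of a graph can be replaced by the constant `p` one at a time.

The coefficients of the closed form satisfy the recurrence `k c_k = -∑ t_b c_{k-b}`, because the
closed form solves the corresponding differential equation; the sums over partitions satisfy it by
marking a part and removing it (`natCast_mul_partitionSum`).
-/

/-! ### The power series of the closed form -/

/-- The coefficient of `X ^ k` in `exp (-∑ t b X ^ b / b)`: the sum over the partitions of `k` of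
`∏ (-t b) / η`, the product being over the parts `b` with multiplicity. -/
noncomputable def partitionSum (t : ℕ → ℂ) (k : ℕ) : ℂ :=
  ∑ l : Nat.Partition k, (l.parts.map fun b => -t b).prod / (partEta l : ℂ)

lemma prod_pow_count_mul_factorial_cons (b : ℕ) (m : Multiset ℕ) :
    ∏ c ∈ (b ::ₘ m).toFinset, c ^ (b ::ₘ m).count c * ((b ::ₘ m).count c)! =
      b * (m.count b + 1) * ∏ c ∈ m.toFinset, c ^ m.count c * (m.count c)! := by
  have h1 : ∏ c ∈ m.toFinset, c ^ m.count c * (m.count c)! =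
      ∏ c ∈ insert b m.toFinset, c ^ m.count c * (m.count c)! := by
    refine Finset.prod_subset (Finset.subset_insert _ _) fun c _ hc => ?_
    rw [Multiset.mem_toFinset] at hc
    simp [Multiset.count_eq_zero_of_notMem hc]
  rw [h1, Multiset.toFinset_cons, ← Finset.mul_prod_erase _ _ (Finset.mem_insert_self _ _),
    ← Finset.mul_prod_erase (insert b m.toFinset) (fun c => c ^ m.count c * (m.count c)!)
      (Finset.mem_insert_self _ _)]
  have h2 : ∀ c ∈ (insert b m.toFinset).erase b,
      c ^ (b ::ₘ m).count c * ((b ::ₘ m).count c)! = c ^ m.count c * (m.count c)! := by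
    intro c hc
    rw [Multiset.count_cons_of_ne (Finset.ne_of_mem_erase hc)]
  rw [Finset.prod_congr rfl h2, Multiset.count_cons_self, Nat.factorial_succ, pow_succ]
  ring

lemma partEta_ne_zero {k : ℕ} (l : Nat.Partition k) : (partEta l : ℂ) ≠ 0 := by
  rw [Nat.cast_ne_zero, partEta, Finset.prod_ne_zero_iff]
  intro b hb
  have := l.parts_pos (Multiset.mem_toFinset.1 hb)
  positivity

lemma sum_mul_count_parts {k : ℕ} (l : Nat.Partition k) :
    ∑ b ∈ Finset.Icc 1 k, b * l.parts.count b = k := by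
  have h : ∑ b ∈ l.parts.toFinset, b * l.parts.count b = k := by
    have := Finset.sum_multiset_count l.parts
    rw [l.parts_sum] at this
    simpa [mul_comm] using this.symm
  refine (Finset.sum_subset (fun b hb => ?_) fun b _ hb => ?_).symm.trans h
  · rw [Multiset.mem_toFinset] at hb
    exact Finset.mem_Icc.2 ⟨l.parts_pos hb, l.le_of_mem_parts hb⟩
  · rw [Multiset.mem_toFinset] at hb
    simp [Multiset.count_eq_zero_of_notMem hb]

/-- Marking a part `b` of a partition of `k` and removing it. -/
lemma natCast_mul_partitionSum (t : ℕ → ℂ) (k : ℕ) :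
    (k : ℂ) * partitionSum t k = -∑ b ∈ Finset.Icc 1 k, t b * partitionSum t (k - b) := by
  classical
  have h1 : (k : ℂ) * partitionSum t k = ∑ b ∈ Finset.Icc 1 k, ∑ l : Nat.Partition k,
      (b * l.parts.count b : ℂ) * ((l.parts.map fun b => -t b).prod / (partEta l : ℂ)) := by
    rw [Finset.sum_comm, partitionSum, Finset.mul_sum]
    refine Finset.sum_congr rfl fun l _ => ?_
    rw [← Finset.sum_mul]
    congr 1
    exact_mod_cast (sum_mul_count_parts l).symm
  rw [h1, ← Finset.sum_neg_distrib]
  refine Finset.sum_congr rfl fun b hb => ?_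
  obtain ⟨hb1, hbk⟩ := Finset.mem_Icc.1 hb
  have h2 : ∑ l : Nat.Partition k,
      (b * l.parts.count b : ℂ) * ((l.parts.map fun b => -t b).prod / (partEta l : ℂ)) =
      ∑ l : {l : Nat.Partition k // b ∈ l.parts},
      (b * l.1.parts.count b : ℂ) * ((l.1.parts.map fun b => -t b).prod / (partEta l.1 : ℂ)) := by
    rw [← Finset.sum_subtype (Finset.univ.filter fun l : Nat.Partition k => b ∈ l.parts) (by simp)
      fun l : Nat.Partition k => (b * l.parts.count b : ℂ) *
        ((l.parts.map fun b => -t b).prod / (partEta l : ℂ))]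
    refine (Finset.sum_subset (Finset.subset_univ _) fun l _ hl => ?_).symm
    rw [Multiset.count_eq_zero_of_notMem (by simpa using hl)]
    simp
  rw [h2, ← (Nat.Partition.partitionWithPartEquiv hb1 hbk).symm.sum_comp, partitionSum,
    Finset.mul_sum, ← Finset.sum_neg_distrib]
  refine Finset.sum_congr rfl fun l _ => ?_
  have h3 : partEta ((Nat.Partition.partitionWithPartEquiv hb1 hbk).symm l).1 =
      b * (l.parts.count b + 1) * partEta l := by
    unfold partEta
    rw [Nat.Partition.partitionWithPartEquiv_symm_apply_parts, prod_pow_count_mul_factorial_cons]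
  rw [h3, Nat.Partition.partitionWithPartEquiv_symm_apply_parts]
  have h4 := partEta_ne_zero l
  have h5 : (b : ℂ) ≠ 0 := by exact_mod_cast (by omega : b ≠ 0)
  have h6 : (l.parts.count b + 1 : ℂ) ≠ 0 := by exact_mod_cast (l.parts.count b).succ_ne_zero
  simp only [Multiset.map_cons, Multiset.prod_cons, Multiset.count_cons_self]
  push_cast
  field_simp

lemma partitionSum_zero (t : ℕ → ℂ) : partitionSum t 0 = 1 := by
  simp [partitionSum, partEta]

/-- The limits of the power sums of the normalized eigenvalues of a `p`-quasi-random sequence: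
`p, p ^ 3, p ^ 4, …` for the exponents `2, 3, 4, …`. The value at `1` is `0` since adjacency matrices
have trace zero, and the zero values exclude partitions with parts less than `2`. -/
noncomputable def quasiPowerSum (p : ℝ) (b : ℕ) : ℂ :=
  if b < 2 then 0 else if b = 2 then p else p ^ b

lemma quasiCoeff_eq_partitionSum (p : ℝ) (k : ℕ) :
    (quasiCoeff p k : ℂ) = partitionSum (quasiPowerSum p) k := by
  have key : ∀ m : Multiset ℕ, (∀ b ∈ m, 2 ≤ b) → m.count 2 ≤ m.sum ∧
      (m.map fun b => -quasiPowerSum p b).prod = (-1) ^ m.card * (p : ℂ) ^ (m.sum - m.count 2) := by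
    intro m
    induction m using Multiset.induction with
    | empty => simp
    | cons b m ih =>
      intro h
      obtain ⟨ih1, ih2⟩ := ih fun c hc => h c (Multiset.mem_cons_of_mem hc)
      have hb := h b (Multiset.mem_cons_self _ _)
      rw [Multiset.map_cons, Multiset.prod_cons, ih2, Multiset.card_cons, Multiset.sum_cons]
      by_cases hb2 : b = 2
      · subst hb2
        rw [Multiset.count_cons_self]
        refine ⟨by omega, ?_⟩
        rw [show 2 + m.sum - (m.count 2 + 1) = (m.sum - m.count 2) + 1 by omega]
        simp only [quasiPowerSum, lt_irrefl, if_false, if_true]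
        ring
      · rw [Multiset.count_cons_of_ne (Ne.symm hb2)]
        refine ⟨by omega, ?_⟩
        rw [show b + m.sum - m.count 2 = b + (m.sum - m.count 2) by omega, pow_add]
        simp only [quasiPowerSum, not_lt.2 hb, hb2, if_false]
        ring
  rw [quasiCoeff, partitionSum, Complex.ofReal_sum, Finset.sum_filter]
  refine Finset.sum_congr rfl fun l _ => ?_
  split_ifs with h
  · rw [(key l.parts h).2, l.parts_sum]
    push_cast
    rfl
  · push Not at h
    obtain ⟨b, hb, hb2⟩ := h
    rw [Multiset.prod_eq_zero, zero_div]
    rw [Multiset.mem_map]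
    exact ⟨b, hb, by simp [quasiPowerSum, hb2]⟩

/-- The formal power series `c` converges absolutely on all of `ℂ`, with sum `f`; the products of
such series are controlled by `HasEntireSum.mul`. -/
def HasEntireSum (c : PowerSeries ℂ) (f : ℂ → ℂ) : Prop :=
  ∀ z, Summable (fun k => ‖z ^ k * c.coeff k‖) ∧ HasSum (fun k => z ^ k * c.coeff k) (f z)

lemma HasEntireSum.mul {c d : PowerSeries ℂ} {f g : ℂ → ℂ} (hc : HasEntireSum c f)
    (hd : HasEntireSum d g) : HasEntireSum (c * d) fun z => f z * g z := by
  intro z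
  have h : ∀ k, z ^ k * (c * d).coeff k = ∑ q ∈ Finset.HasAntidiagonal.antidiagonal k,
      (z ^ q.1 * c.coeff q.1) * (z ^ q.2 * d.coeff q.2) := by
    intro k
    rw [PowerSeries.coeff_mul, Finset.mul_sum]
    refine Finset.sum_congr rfl fun q hq => ?_
    rw [← Finset.HasAntidiagonal.mem_antidiagonal.1 hq, pow_add]
    ring
  have hs := summable_norm_sum_mul_antidiagonal_of_summable_norm (hc z).1 (hd z).1
  simp only [← h] at hs
  refine ⟨hs, ?_⟩
  change HasSum _ (f z * g z)
  rw [← (hc z).2.tsum_eq, ← (hd z).2.tsum_eq,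
    tsum_mul_tsum_eq_tsum_sum_antidiagonal_of_summable_norm (hc z).1 (hd z).1]
  simp only [← h]
  exact hs.of_norm.hasSum

lemma hasEntireSum_exp (a : ℂ) :
    HasEntireSum (PowerSeries.mk fun n => a ^ n / n !) fun z => Complex.exp (a * z) := by
  intro z
  have h : (fun k => z ^ k * (PowerSeries.mk fun n => a ^ n / (n ! : ℂ)).coeff k) =
      fun k => (a * z) ^ k / k ! := by
    funext k
    rw [PowerSeries.coeff_mk, mul_pow]
    ring
  have hs := NormedSpace.norm_expSeries_div_summable (a * z)
  rw [show (fun n => ‖(a * z) ^ n / (n ! : ℂ)‖) = fun n => ‖(fun k => (a * z) ^ k / (k ! : ℂ)) n‖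
    from rfl, ← h] at hs
  refine ⟨hs, ?_⟩
  rw [h]
  rw [Complex.exp_eq_exp_ℂ]
  exact NormedSpace.expSeries_div_hasSum_exp (a * z)

lemma hasEntireSum_exp_sq (a : ℂ) :
    HasEntireSum (PowerSeries.mk fun n => if Even n then a ^ (n / 2) / ((n / 2) ! : ℂ) else 0)
      fun z => Complex.exp (a * z ^ 2) := by
  intro z
  set u : ℕ → ℂ := fun k => z ^ k * (PowerSeries.mk fun n =>
    if Even n then a ^ (n / 2) / ((n / 2) ! : ℂ) else 0).coeff k with hu
  have hinj : Function.Injective fun k : ℕ => 2 * k := fun a b h => by simpa using h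
  have h0 : ∀ k ∉ Set.range fun k : ℕ => 2 * k, u k = 0 := by
    intro k hk
    have : ¬ Even k := fun ⟨r, hr⟩ => hk ⟨r, by simp; omega⟩
    simp [hu, this]
  have h : u ∘ (fun k : ℕ => 2 * k) = fun k => (a * z ^ 2) ^ k / k ! := by
    funext k
    simp only [hu, Function.comp, PowerSeries.coeff_mk, even_two_mul, if_true,
      Nat.mul_div_cancel_left k two_pos]
    rw [mul_pow, ← pow_mul]
    ring
  constructor
  · refine (hinj.summable_iff (f := fun k => ‖u k‖) fun k hk => by rw [h0 k hk, norm_zero]).1 ?_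
    have hs := NormedSpace.norm_expSeries_div_summable (a * z ^ 2)
    rw [show (fun n => ‖(a * z ^ 2) ^ n / (n ! : ℂ)‖) =
      fun n => ‖(fun k => (a * z ^ 2) ^ k / (k ! : ℂ)) n‖ from rfl, ← h] at hs
    exact hs
  · refine (hinj.hasSum_iff h0).1 ?_
    rw [h, Complex.exp_eq_exp_ℂ]
    exact NormedSpace.expSeries_div_hasSum_exp (a * z ^ 2)

lemma hasEntireSum_one_sub (a : ℂ) :
    HasEntireSum (1 - PowerSeries.C a * PowerSeries.X) fun z => 1 - a * z := by
  intro z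
  have h0 : ∀ k ∉ Finset.range 2,
      z ^ k * (1 - PowerSeries.C a * PowerSeries.X : PowerSeries ℂ).coeff k = 0 := by
    intro k hk
    rw [Finset.mem_range, not_lt] at hk
    simp [PowerSeries.coeff_one, PowerSeries.coeff_X, show k ≠ 0 by omega, show k ≠ 1 by omega]
  refine ⟨summable_of_ne_finset_zero (s := Finset.range 2) fun k hk => by rw [h0 k hk, norm_zero],
    ?_⟩
  have hs : HasSum (fun k => z ^ k * (1 - PowerSeries.C a * PowerSeries.X : PowerSeries ℂ).coeff k)
      _ := hasSum_sum_of_ne_finset_zero h0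
  convert hs using 1
  simp [Finset.sum_range_succ, PowerSeries.coeff_one, PowerSeries.coeff_X]
  ring

lemma derivative_exp_mk (a : ℂ) :
    PowerSeries.derivative ℂ (PowerSeries.mk fun n => a ^ n / (n ! : ℂ)) =
      PowerSeries.C a * PowerSeries.mk fun n => a ^ n / (n ! : ℂ) := by
  ext n
  rw [PowerSeries.coeff_derivative, PowerSeries.coeff_mk, PowerSeries.coeff_C_mul,
    PowerSeries.coeff_mk, Nat.factorial_succ, pow_succ]
  have h1 : (n ! : ℂ) ≠ 0 := by exact_mod_cast n.factorial_ne_zero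
  have h2 : (n + 1 : ℂ) ≠ 0 := by exact_mod_cast n.succ_ne_zero
  push_cast
  field_simp

lemma derivative_exp_sq_mk (a : ℂ) :
    PowerSeries.derivative ℂ
      (PowerSeries.mk fun n => if Even n then a ^ (n / 2) / ((n / 2) ! : ℂ) else 0) =
      PowerSeries.C (2 * a) * (PowerSeries.X *
        PowerSeries.mk fun n => if Even n then a ^ (n / 2) / ((n / 2) ! : ℂ) else 0) := by
  ext n
  rw [PowerSeries.coeff_derivative, PowerSeries.coeff_mk, PowerSeries.coeff_C_mul]
  cases n with
  | zero => simp
  | succ m =>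
    rw [PowerSeries.coeff_succ_X_mul, PowerSeries.coeff_mk]
    by_cases hm : Even m
    · obtain ⟨r, rfl⟩ := hm
      rw [if_pos ⟨r + 1, by ring⟩, if_pos ⟨r, rfl⟩, show (r + r + 1 + 1) / 2 = r + 1 by omega,
        show (r + r) / 2 = r by omega, Nat.factorial_succ, pow_succ]
      have h1 : (r ! : ℂ) ≠ 0 := by exact_mod_cast r.factorial_ne_zero
      have h2 : (r + 1 : ℂ) ≠ 0 := by exact_mod_cast r.succ_ne_zero
      push_cast
      field_simp
      ring
    · rw [if_neg (by simpa [Nat.even_add_one] using hm), if_neg hm]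
      simp

/-- The recurrence of `natCast_mul_partitionSum` determines a formal power series with constant
coefficient `1`. -/
lemma coeff_eq_partitionSum {c : PowerSeries ℂ} {t : ℕ → ℂ} (h0 : c.coeff 0 = 1) (ht : t 0 = 0)
    (h : PowerSeries.X * PowerSeries.derivative ℂ c = -(PowerSeries.mk t * c)) (k : ℕ) :
    c.coeff k = partitionSum t k := by
  induction k using Nat.strong_induction_on with
  | _ k ih =>
    rcases Nat.eq_zero_or_pos k with rfl | hk
    · rw [h0, partitionSum_zero]
    · have h1 := congrArg (PowerSeries.coeff k) h
      have h2 : (k : ℂ) * c.coeff k = -∑ b ∈ Finset.Icc 1 k, t b * c.coeff (k - b) := by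
        obtain ⟨m, rfl⟩ := Nat.exists_eq_succ_of_ne_zero hk.ne'
        rw [Nat.succ_eq_add_one, PowerSeries.coeff_succ_X_mul, PowerSeries.coeff_derivative] at h1
        rw [mul_comm, Nat.succ_eq_add_one]
        push_cast
        rw [h1, map_neg, PowerSeries.coeff_mul,
          Finset.Nat.sum_antidiagonal_eq_sum_range_succ_mk, Finset.sum_range_eq_add_Ico _ (by omega)]
        simp only [PowerSeries.coeff_mk, ht, zero_mul, zero_add]
        rfl
      have h3 : (k : ℂ) ≠ 0 := by exact_mod_cast hk.ne'
      apply mul_left_cancel₀ h3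
      rw [h2, natCast_mul_partitionSum]
      congr 1
      refine Finset.sum_congr rfl fun b hb => ?_
      rw [ih _ (by have := (Finset.mem_Icc.1 hb).1; omega)]

/-- The closed form of the characteristic power series of a `p`-quasi-random sequence. -/
noncomputable def quasiPsi (p : ℝ) (z : ℂ) : ℂ :=
  (1 - p * z) * Complex.exp (p * z - p * (1 - p) / 2 * z ^ 2)

theorem hasSum_quasiCoeff (p : ℝ) (z : ℂ) :
    HasSum (fun k : ℕ => z ^ k * (quasiCoeff p k : ℂ)) (quasiPsi p z) := by
  set L : PowerSeries ℂ := 1 - PowerSeries.C (p : ℂ) * PowerSeries.X with hL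
  set E : PowerSeries ℂ := PowerSeries.mk fun n => (p : ℂ) ^ n / (n ! : ℂ) with hE
  set a : ℂ := -(p * (1 - p) / 2) with ha
  set Q : PowerSeries ℂ :=
    PowerSeries.mk fun n => if Even n then a ^ (n / 2) / ((n / 2) ! : ℂ) else 0 with hQ
  set T : PowerSeries ℂ := PowerSeries.mk (quasiPowerSum p) with hT
  -- `T` is a geometric series up to its first term
  have hLT : L * T = PowerSeries.C (p : ℂ) * PowerSeries.X ^ 2 -
      PowerSeries.C ((p : ℂ) ^ 2 * (1 - p)) * PowerSeries.X ^ 3 := by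
    ext n
    rw [hL, sub_mul, one_mul, mul_assoc, map_sub, PowerSeries.coeff_C_mul, map_sub,
      PowerSeries.coeff_C_mul, PowerSeries.coeff_C_mul, PowerSeries.coeff_X_pow,
      PowerSeries.coeff_X_pow, hT]
    rcases n with _ | _ | _ | _ | n
    · simp [quasiPowerSum]
    · simp [quasiPowerSum, PowerSeries.coeff_succ_X_mul]
    · simp [quasiPowerSum, PowerSeries.coeff_succ_X_mul]
    · simp [quasiPowerSum, PowerSeries.coeff_succ_X_mul]
      ring
    · rw [PowerSeries.coeff_succ_X_mul, PowerSeries.coeff_mk, PowerSeries.coeff_mk]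
      simp only [quasiPowerSum]
      rw [if_neg (by omega), if_neg (by omega), if_neg (by omega), if_neg (by omega),
        if_neg (by omega), if_neg (by omega)]
      ring
  -- the logarithmic derivative of the closed form is `-T / X`
  have hder : PowerSeries.X * PowerSeries.derivative ℂ (L * (E * Q)) = -(T * (L * (E * Q))) := by
    have hEd : PowerSeries.derivative ℂ E = PowerSeries.C (p : ℂ) * E := derivative_exp_mk _
    have hQd : PowerSeries.derivative ℂ Q = PowerSeries.C (2 * a) * (PowerSeries.X * Q) :=
      derivative_exp_sq_mk _
    have hLd : PowerSeries.derivative ℂ L = -PowerSeries.C (p : ℂ) := by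
      simp [hL, Derivation.leibniz]
    have h1 : T * (L * (E * Q)) = (L * T) * (E * Q) := by ring
    rw [h1, hLT, Derivation.leibniz, Derivation.leibniz, hEd, hQd, hLd]
    simp only [smul_eq_mul, hL, ha, map_mul, map_sub, map_neg, map_pow, map_one]
    have h2 : PowerSeries.C (2 : ℂ) * PowerSeries.C ((p : ℂ) * (1 - p) / 2) =
        PowerSeries.C (p : ℂ) * (1 - PowerSeries.C (p : ℂ)) := by
      rw [← map_mul, ← map_one PowerSeries.C, ← map_sub, ← map_mul]
      congr 1
      ring
    linear_combination (-(1 - PowerSeries.C (p : ℂ) * PowerSeries.X) * (E * Q)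
      * PowerSeries.X ^ 2) * h2
  have hc := coeff_eq_partitionSum (c := L * (E * Q)) (t := quasiPowerSum p)
    (by simp [hL, hE, hQ]) (by simp [quasiPowerSum]) hder
  have hsum := (((hasEntireSum_one_sub (p : ℂ)).mul
    ((hasEntireSum_exp (p : ℂ)).mul (hasEntireSum_exp_sq a))) z).2
  have hval : quasiPsi p z =
      (1 - p * z) * (Complex.exp (p * z) * Complex.exp (a * z ^ 2)) := by
    rw [quasiPsi, ← Complex.exp_add]
    congr 2
    rw [ha]
    ring
  rw [hval]
  convert hsum using 2 with k
  rw [quasiCoeff_eq_partitionSum, ← hc]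

/-! ### Estimates for the factors of the regularized determinant -/

lemma abs_log_one_add_sub_le {x : ℝ} (h0 : 0 ≤ x) (h1 : x ≤ 1 / 2) :
    |Real.log (1 + x) - (x - x ^ 2 / 2)| ≤ 2 * x ^ 3 := by
  have h := Real.abs_log_sub_add_sum_range_le (x := -x) (by rw [abs_neg, abs_of_nonneg h0]; linarith) 2
  rw [abs_neg, abs_of_nonneg h0] at h
  have h2 : x ^ 3 / (1 - x) ≤ 2 * x ^ 3 := by
    rw [div_le_iff₀ (by linarith)]
    nlinarith [pow_nonneg h0 3]
  refine (le_of_eq ?_).trans (h.trans h2)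
  congr 1
  simp [Finset.sum_range_succ]
  ring

lemma norm_log_one_sub_add_le {w : ℂ} (hw : ‖w‖ ≤ 1 / 2) :
    ‖Complex.log (1 - w) + w + w ^ 2 / 2‖ ≤ ‖w‖ ^ 3 := by
  have h := Complex.norm_log_sub_logTaylor_le 2 (z := -w) (by rw [norm_neg]; linarith)
  have h1 : Complex.log (1 + -w) - Complex.logTaylor (2 + 1) (-w) =
      Complex.log (1 - w) + w + w ^ 2 / 2 := by
    simp [Complex.logTaylor, Finset.sum_range_succ, ← sub_eq_add_neg]
    ring
  rw [h1, norm_neg] at h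
  have h2 : (1 - ‖w‖)⁻¹ ≤ 2 := by
    rw [inv_le_comm₀ (by linarith) two_pos]
    linarith
  refine h.trans ?_
  have h3 := pow_nonneg (norm_nonneg w) 3
  norm_num
  nlinarith

lemma one_sub_ne_zero_of_norm_le {w : ℂ} (hw : ‖w‖ ≤ 1 / 2) : 1 - w ≠ 0 := by
  intro h
  rw [← sub_eq_zero.1 h, norm_one] at hw
  norm_num at hw

/-- The factor of the determinant regularized once more is `1 + O(w ^ 3)`. -/
lemma norm_one_sub_mul_exp_add_sq_sub_one_le {w : ℂ} (hw : ‖w‖ ≤ 1 / 2) :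
    ‖(1 - w) * Complex.exp (w + w ^ 2 / 2) - 1‖ ≤ 2 * ‖w‖ ^ 3 := by
  have h := norm_log_one_sub_add_le hw
  have h1 : (1 - w) * Complex.exp (w + w ^ 2 / 2) =
      Complex.exp (Complex.log (1 - w) + w + w ^ 2 / 2) := by
    rw [add_assoc, Complex.exp_add (Complex.log _), Complex.exp_log (one_sub_ne_zero_of_norm_le hw)]
  have h2 : ‖w‖ ^ 3 ≤ 1 := pow_le_one₀ (norm_nonneg _) (by linarith)
  rw [h1]
  exact (Complex.norm_exp_sub_one_le (h.trans h2)).trans (by linarith)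

lemma norm_one_sub_mul_exp_sub_one_le {w : ℂ} (hw : ‖w‖ ≤ 1 / 2) :
    ‖(1 - w) * Complex.exp w - 1‖ ≤ 2 * ‖w‖ ^ 2 := by
  have h := norm_log_one_sub_add_le hw
  have h1 : (1 - w) * Complex.exp w = Complex.exp (Complex.log (1 - w) + w) := by
    rw [Complex.exp_add, Complex.exp_log (one_sub_ne_zero_of_norm_le hw)]
  have h2 : ‖Complex.log (1 - w) + w‖ ≤ ‖w‖ ^ 2 := by
    have h3 : Complex.log (1 - w) + w = (Complex.log (1 - w) + w + w ^ 2 / 2) - w ^ 2 / 2 := by ring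
    rw [h3]
    refine (norm_sub_le _ _).trans ?_
    rw [norm_div, norm_pow, Complex.norm_ofNat]
    nlinarith [sq_nonneg ‖w‖, norm_nonneg w]
  have h4 : ‖w‖ ^ 2 ≤ 1 := pow_le_one₀ (norm_nonneg _) (by linarith)
  rw [h1]
  exact (Complex.norm_exp_sub_one_le (h2.trans h4)).trans (by linarith)

lemma multipliable_one_sub_mul_exp {ι : Type*} {μ : ι → ℝ} (h : Summable fun i => μ i ^ 2) (z : ℂ) :
    Multipliable fun i => (1 - (μ i : ℂ) * z) * Complex.exp ((μ i : ℂ) * z) := by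
  have h1 : Multipliable fun i => 1 + ((1 - (μ i : ℂ) * z) * Complex.exp ((μ i : ℂ) * z) - 1) := by
    apply multipliable_one_add_of_summable
    have h2 : Summable fun i => 2 * ‖z‖ ^ 2 * μ i ^ 2 := h.mul_left _
    refine Summable.of_norm_bounded_eventually h2 ?_
    filter_upwards [h2.tendsto_cofinite_zero.eventually_le_const (by norm_num : (0 : ℝ) < 1 / 2)]
      with i hi
    have h3 : ‖(μ i : ℂ) * z‖ ^ 2 = ‖z‖ ^ 2 * μ i ^ 2 := by
      rw [norm_mul, Complex.norm_real, mul_pow, Real.norm_eq_abs, sq_abs]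
      ring
    have h4 : ‖(μ i : ℂ) * z‖ ≤ 1 / 2 := by
      refine (sq_le_sq₀ (norm_nonneg _) (by norm_num)).1 ?_
      rw [h3]
      linarith
    rw [norm_norm]
    refine (norm_one_sub_mul_exp_sub_one_le h4).trans (le_of_eq ?_)
    rw [h3]
    ring
  simpa using h1

/-- Multiplying the values at `±i√u` of a regularized product turns it into a real one, whose
logarithm has power sums of the `μ i` as its Taylor coefficients. -/
lemma exists_log_mul_of_hasProd {ι : Type*} {μ : ι → ℝ} {s c : ℝ}
    (hs : HasSum (fun i => μ i ^ 2) s) (hs1 : s ≤ 1) (hc : HasSum (fun i => μ i ^ 4) c)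
    {u : ℝ} (hu0 : 0 ≤ u) (hu1 : u ≤ 1 / 2) {z E₁ E₂ : ℂ} (hz : z ^ 2 = -u)
    (h₁ : HasProd (fun i => (1 - (μ i : ℂ) * z) * Complex.exp ((μ i : ℂ) * z)) E₁)
    (h₂ : HasProd (fun i => (1 - (μ i : ℂ) * -z) * Complex.exp ((μ i : ℂ) * -z)) E₂) :
    ∃ L : ℝ, E₁ * E₂ = Complex.exp L ∧ |L - (s * u - c * u ^ 2 / 2)| ≤ 2 * u ^ 3 := by
  have hμ1 : ∀ i, μ i ^ 2 ≤ 1 := fun i =>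
    (le_hasSum hs i fun j _ => sq_nonneg _).trans hs1
  have hlog : ∀ i, |Real.log (1 + μ i ^ 2 * u) - (μ i ^ 2 * u - μ i ^ 4 * u ^ 2 / 2)| ≤
      2 * u ^ 3 * μ i ^ 2 := by
    intro i
    have h0 := sq_nonneg (μ i)
    refine (le_of_eq ?_).trans ((abs_log_one_add_sub_le (x := μ i ^ 2 * u) (by positivity)
      (by nlinarith [hμ1 i])).trans ?_)
    · congr 1
      ring
    · rw [mul_pow]
      have h3 : (μ i ^ 2) ^ 3 ≤ μ i ^ 2 := by
        have := hμ1 i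
        calc (μ i ^ 2) ^ 3 = μ i ^ 2 * (μ i ^ 2) ^ 2 := by ring
          _ ≤ μ i ^ 2 * 1 := by gcongr; exact pow_le_one₀ h0 this
          _ = μ i ^ 2 := mul_one _
      have := pow_nonneg hu0 3
      nlinarith
  have hsum0 : HasSum (fun i => μ i ^ 2 * u - μ i ^ 4 * u ^ 2 / 2) (s * u - c * u ^ 2 / 2) := by
    simpa [mul_div_assoc] using (hs.mul_right u).sub (hc.mul_right (u ^ 2 / 2))
  have hbd : HasSum (fun i => 2 * u ^ 3 * μ i ^ 2) (2 * u ^ 3 * s) := hs.mul_left _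
  have hdiff : Summable fun i =>
      Real.log (1 + μ i ^ 2 * u) - (μ i ^ 2 * u - μ i ^ 4 * u ^ 2 / 2) :=
    Summable.of_norm_bounded hbd.summable hlog
  have hsumlog : Summable fun i => Real.log (1 + μ i ^ 2 * u) := by
    simpa using hdiff.add hsum0.summable
  refine ⟨∑' i, Real.log (1 + μ i ^ 2 * u), ?_, ?_⟩
  · have h3 := h₁.mul h₂
    have h4 : HasProd (fun i => (1 - (μ i : ℂ) * z) * Complex.exp ((μ i : ℂ) * z) *
        ((1 - (μ i : ℂ) * -z) * Complex.exp ((μ i : ℂ) * -z)))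
        (Complex.exp (∑' i, Real.log (1 + μ i ^ 2 * u) : ℝ)) := by
      have h5 : HasSum (fun i => ((Real.log (1 + μ i ^ 2 * u) : ℝ) : ℂ))
          ((∑' i, Real.log (1 + μ i ^ 2 * u) : ℝ) : ℂ) := Complex.hasSum_ofReal.2 hsumlog.hasSum
      convert h5.cexp using 1
      funext i
      have hpos : 0 < 1 + μ i ^ 2 * u := by positivity
      simp only [Function.comp]
      rw [← Complex.ofReal_exp, Real.exp_log hpos]
      have h6 : Complex.exp ((μ i : ℂ) * z) * Complex.exp ((μ i : ℂ) * -z) = 1 := by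
        rw [← Complex.exp_add]
        simp
      push_cast
      linear_combination (1 - (μ i : ℂ) * z) * (1 + (μ i : ℂ) * z) * h6 - (μ i : ℂ) ^ 2 * hz
    exact h3.unique h4
  · have h3 := hdiff.hasSum
    have h4 : ∑' i, (Real.log (1 + μ i ^ 2 * u) - (μ i ^ 2 * u - μ i ^ 4 * u ^ 2 / 2)) =
        ∑' i, Real.log (1 + μ i ^ 2 * u) - (s * u - c * u ^ 2 / 2) := by
      rw [hsumlog.tsum_sub hsum0.summable, hsum0.tsum_eq]
    rw [← h4]
    refine (tsum_of_norm_bounded (f := fun i => Real.log (1 + μ i ^ 2 * u) -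
      (μ i ^ 2 * u - μ i ^ 4 * u ^ 2 / 2)) hbd hlog).trans ?_
    have := pow_nonneg hu0 3
    nlinarith

lemma exists_log_quasiPsi {p : ℝ} (hp : p ∈ Set.Icc (0 : ℝ) 1) {u : ℝ} (hu0 : 0 ≤ u)
    (hu1 : u ≤ 1 / 2) {z : ℂ} (hz : z ^ 2 = -u) :
    ∃ L : ℝ, quasiPsi p z * quasiPsi p (-z) = Complex.exp L ∧
      |L - (p * u - p ^ 4 * u ^ 2 / 2)| ≤ 2 * u ^ 3 := by
  obtain ⟨hp0, hp1⟩ := hp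
  have hp2 : p ^ 2 ≤ 1 := pow_le_one₀ hp0 hp1
  have h0 : 0 ≤ p ^ 2 * u := by positivity
  refine ⟨Real.log (1 + p ^ 2 * u) + p * (1 - p) * u, ?_, ?_⟩
  · rw [Complex.ofReal_add, Complex.exp_add, ← Complex.ofReal_exp, Real.exp_log (by linarith),
      quasiPsi, quasiPsi]
    have h1 : Complex.exp (p * z - p * (1 - p) / 2 * z ^ 2) *
        Complex.exp (p * -z - p * (1 - p) / 2 * (-z) ^ 2) =
        Complex.exp ((p * (1 - p) * u : ℝ) : ℂ) := by
      rw [← Complex.exp_add]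
      congr 1
      push_cast
      linear_combination (-(p : ℂ) * (1 - p)) * hz
    push_cast at h1 ⊢
    linear_combination (1 - (p : ℂ) * z) * (1 + p * z) * h1 -
      (p : ℂ) ^ 2 * Complex.exp (p * (1 - p) * u) * hz
  · refine (le_of_eq ?_).trans ((abs_log_one_add_sub_le h0 (by nlinarith)).trans ?_)
    · congr 1
      ring
    · have : (p ^ 2 * u) ^ 3 ≤ u ^ 3 := by
        apply pow_le_pow_left₀ h0
        nlinarith
      linarith

/-- The coefficients of `u` and `u ^ 2` in a convergent family of functions, known up to
`O(u ^ 3)`, converge. -/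
lemma tendsto_coeffs_of_tendsto {e c : ℕ → ℝ} {a b : ℝ} {L : ℕ → ℝ → ℝ} {L' : ℝ → ℝ}
    (hc : ∀ᶠ n in atTop, |c n| ≤ 1)
    (hL : ∀ u, 0 < u → u ≤ 1 / 2 → ∀ᶠ n in atTop, |L n u - (e n * u - c n * u ^ 2 / 2)| ≤ 2 * u ^ 3)
    (hL' : ∀ u, 0 < u → u ≤ 1 / 2 → |L' u - (a * u - b * u ^ 2 / 2)| ≤ 2 * u ^ 3)
    (h : ∀ u, 0 < u → u ≤ 1 / 2 → Tendsto (fun n => L n u) atTop (𝓝 (L' u))) :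
    Tendsto e atTop (𝓝 a) ∧ Tendsto c atTop (𝓝 b) := by
  have he : Tendsto e atTop (𝓝 a) := by
    rw [Metric.tendsto_nhds]
    intro ε hε
    -- all errors are at most `u * (6 + |b|)` after division by `u`
    set u : ℝ := min (1 / 2) (ε / (6 + |b|)) with hu
    have hb := abs_nonneg b
    have hu0 : 0 < u := lt_min (by norm_num) (by positivity)
    have hu1 : u ≤ 1 / 2 := min_le_left _ _
    have hu2 : u * (6 + |b|) ≤ ε := by
      rw [← le_div_iff₀ (by positivity)]
      exact min_le_right _ _
    have h1 := (Metric.tendsto_nhds.1 (h u hu0 hu1)) (u ^ 2) (by positivity)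
    filter_upwards [h1, hL u hu0 hu1, hc] with n h2 h3 h4
    have h5 := hL' u hu0 hu1
    rw [Real.dist_eq] at h2 ⊢
    have h6 : (e n - a) * u = (L n u - L' u) - (L n u - (e n * u - c n * u ^ 2 / 2)) +
        (L' u - (a * u - b * u ^ 2 / 2)) + (c n - b) * (u ^ 2 / 2) := by ring
    have h7 : |(c n - b) * (u ^ 2 / 2)| ≤ (1 + |b|) * (u ^ 2 / 2) := by
      rw [abs_mul, abs_of_pos (by positivity : 0 < u ^ 2 / 2)]
      gcongr
      exact (abs_sub _ _).trans (by linarith)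
    have h8 : |(e n - a) * u| < u ^ 2 + 2 * u ^ 3 + 2 * u ^ 3 + (1 + |b|) * (u ^ 2 / 2) := by
      rw [h6]
      refine (abs_add_le _ _).trans_lt ?_
      refine (add_le_add_left ((abs_add_le _ _).trans
        (add_le_add_left (abs_sub _ _) _)) _).trans_lt ?_
      linarith
    rw [abs_mul, abs_of_pos hu0] at h8
    have h9 : |e n - a| < u + 2 * u ^ 2 + 2 * u ^ 2 + (1 + |b|) * (u / 2) := by
      refine lt_of_mul_lt_mul_right (h8.trans_le (le_of_eq ?_)) hu0.le
      ring
    nlinarith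
  refine ⟨he, ?_⟩
  rw [Metric.tendsto_nhds]
  intro ε hε
  -- the errors add up to `14 * u`, once `e` is within `u ^ 2` of its limit
  set u : ℝ := min (1 / 2) (ε / 16) with hu
  have hu0 : 0 < u := lt_min (by norm_num) (by positivity)
  have hu1 : u ≤ 1 / 2 := min_le_left _ _
  have hu2 : u ≤ ε / 16 := min_le_right _ _
  have h1 := (Metric.tendsto_nhds.1 (h u hu0 hu1)) (u ^ 3) (by positivity)
  have h1' := (Metric.tendsto_nhds.1 he) (u ^ 2) (by positivity)
  filter_upwards [h1, h1', hL u hu0 hu1] with n h2 h2' h3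
  have h5 := hL' u hu0 hu1
  rw [Real.dist_eq] at h2 h2' ⊢
  have h6 : (c n - b) * (u ^ 2 / 2) = (e n - a) * u - (L n u - L' u) +
      (L n u - (e n * u - c n * u ^ 2 / 2)) - (L' u - (a * u - b * u ^ 2 / 2)) := by ring
  have h7 : |(e n - a) * u| ≤ u ^ 3 := by
    rw [abs_mul, abs_of_pos hu0]
    calc |e n - a| * u ≤ u ^ 2 * u := by gcongr
      _ = u ^ 3 := by ring
  have h8 : |(c n - b) * (u ^ 2 / 2)| < 7 * u ^ 3 := by
    rw [h6]
    rw [abs_lt] at h2 ⊢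
    rw [abs_le] at h3 h5 h7
    have := pow_pos hu0 3
    constructor <;> linarith [h2.1, h2.2, h3.1, h3.2, h5.1, h5.2, h7.1, h7.2]
  rw [abs_mul, abs_of_pos (by positivity : 0 < u ^ 2 / 2)] at h8
  have h9 : |c n - b| < 14 * u := by
    refine lt_of_mul_lt_mul_right (h8.trans_le (le_of_eq ?_)) (by positivity : 0 ≤ u ^ 2 / 2)
    ring
  linarith

/-- The values of `ψ` at all pairs `±z` with `z` imaginary determine the first two power sums in
the limit. -/
lemma tendsto_coeffs_of_tendsto_mul {e c : ℕ → ℝ} {p : ℝ} (hp : p ∈ Set.Icc (0 : ℝ) 1)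
    {ψ : ℕ → ℂ → ℂ} (hc : ∀ᶠ n in atTop, |c n| ≤ 1)
    (hψ : ∀ᶠ n in atTop, ∀ (u : ℝ) (z : ℂ), 0 < u → u ≤ 1 / 2 → z ^ 2 = -u → ∃ L : ℝ,
      ψ n z * ψ n (-z) = Complex.exp L ∧ |L - (e n * u - c n * u ^ 2 / 2)| ≤ 2 * u ^ 3)
    (h : ∀ z, Tendsto (fun n => ψ n z) atTop (𝓝 (quasiPsi p z))) :
    Tendsto e atTop (𝓝 p) ∧ Tendsto c atTop (𝓝 (p ^ 4)) := by
  have hsq : ∀ u : ℝ, 0 < u → (Complex.I * (Real.sqrt u : ℝ)) ^ 2 = -(u : ℂ) := by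
    intro u hu
    rw [mul_pow, Complex.I_sq, ← Complex.ofReal_pow, Real.sq_sqrt hu.le]
    ring
  set M : ℕ → ℝ → ℂ := fun n u => ψ n (Complex.I * (Real.sqrt u : ℝ)) *
    ψ n (-(Complex.I * (Real.sqrt u : ℝ))) with hM
  set M' : ℝ → ℂ := fun u => quasiPsi p (Complex.I * (Real.sqrt u : ℝ)) *
    quasiPsi p (-(Complex.I * (Real.sqrt u : ℝ))) with hM'
  have hlog : ∀ (x : ℂ) (l : ℝ), x = Complex.exp l → Real.log ‖x‖ = l := by
    intro x l hx
    rw [hx, Complex.norm_exp, Complex.ofReal_re, Real.log_exp]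
  refine tendsto_coeffs_of_tendsto (L := fun n u => Real.log ‖M n u‖)
    (L' := fun u => Real.log ‖M' u‖) hc (fun u hu0 hu1 => ?_) (fun u hu0 hu1 => ?_)
    fun u hu0 hu1 => ?_
  · filter_upwards [hψ] with n hn
    obtain ⟨l, h1, h2⟩ := hn u _ hu0 hu1 (hsq u hu0)
    rwa [hlog _ l h1]
  · obtain ⟨l, h1, h2⟩ := exists_log_quasiPsi hp hu0.le hu1 (hsq u hu0)
    rwa [hlog _ l h1]
  · obtain ⟨l, h1, -⟩ := exists_log_quasiPsi hp hu0.le hu1 (hsq u hu0)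
    refine (((h _).mul (h _)).norm).log ?_
    rw [h1]
    exact norm_ne_zero_iff.2 (Complex.exp_ne_zero _)

/-! ### The eigenvalues of a finite graph -/

section FiniteGraph

variable {V : Type*} [Fintype V]

open Classical in
/-- The edge density `t(K₂, G)`, the mean of the entries of the adjacency matrix. -/
noncomputable def edgeDensity (G : SimpleGraph V) : ℝ :=
  (∑ x, ∑ y, G.adjMatrix ℝ x y) / (Fintype.card V : ℝ) ^ 2

open Classical in
/-- The density `t(C₄, G)` of the four-cycle, through the codegrees of `G`. -/
noncomputable def fourCycleDensity (G : SimpleGraph V) : ℝ :=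
  (∑ x, ∑ x', (∑ y, G.adjMatrix ℝ x y * G.adjMatrix ℝ x' y) ^ 2) / (Fintype.card V : ℝ) ^ 4

lemma Matrix.IsHermitian.trace_pow_eq_sum_eigenvalues_pow [DecidableEq V] {A : Matrix V V ℝ}
    (hA : A.IsHermitian) (k : ℕ) : (A ^ k).trace = ∑ i, hA.eigenvalues i ^ k := by
  have h := hA.spectral_theorem
  have h1 : A ^ k = Unitary.conjStarAlgAut ℝ _ hA.eigenvectorUnitary
      (Matrix.diagonal (RCLike.ofReal ∘ hA.eigenvalues) ^ k) := by
    rw [map_pow, ← h]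
  rw [h1, Unitary.conjStarAlgAut_apply, Matrix.trace_mul_cycle, Unitary.coe_star_mul_self, one_mul,
    Matrix.diagonal_pow, Matrix.trace_diagonal]
  rfl

/-- The mean of the entries of a symmetric matrix is at most its largest eigenvalue. -/
lemma Matrix.IsHermitian.exists_sum_le_eigenvalues_mul_card [DecidableEq V] [Nonempty V]
    {A : Matrix V V ℝ} (hA : A.IsHermitian) :
    ∃ i, ∑ x, ∑ y, A x y ≤ hA.eigenvalues i * Fintype.card V := by
  obtain ⟨i, -, hi⟩ := Finset.exists_max_image Finset.univ hA.eigenvalues Finset.univ_nonempty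
  refine ⟨i, ?_⟩
  set U := (hA.eigenvectorUnitary : Matrix V V ℝ) with hU
  have hent : ∀ x y, A x y = ∑ k, U x k * hA.eigenvalues k * U y k := by
    intro x y
    have h := congrFun (congrFun hA.spectral_theorem x) y
    rw [Unitary.conjStarAlgAut_apply, Matrix.mul_apply] at h
    rw [h]
    refine Finset.sum_congr rfl fun k _ => ?_
    rw [Matrix.mul_diagonal]
    rfl
  have hone : ∀ x y, ∑ k, U x k * U y k = (1 : Matrix V V ℝ) x y := by
    intro x y
    have h : U * star U = 1 := Unitary.coe_mul_star_self hA.eigenvectorUnitary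
    rw [← h, Matrix.mul_apply]
    rfl
  have hquad : ∀ c : V → ℝ, ∑ x, ∑ y, ∑ k, U x k * c k * U y k = ∑ k, c k * (∑ x, U x k) ^ 2 := by
    intro c
    calc _ = ∑ x, ∑ k, ∑ y, U x k * c k * U y k :=
          Finset.sum_congr rfl fun x _ => Finset.sum_comm
      _ = ∑ k, ∑ x, ∑ y, U x k * c k * U y k := Finset.sum_comm
      _ = _ := by
          refine Finset.sum_congr rfl fun k _ => ?_
          rw [sq, Finset.sum_mul_sum, Finset.mul_sum]
          refine Finset.sum_congr rfl fun x _ => ?_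
          rw [Finset.mul_sum]
          exact Finset.sum_congr rfl fun y _ => by ring
  have h1 : ∑ x, ∑ y, A x y = ∑ k, hA.eigenvalues k * (∑ x, U x k) ^ 2 := by
    simp_rw [hent]
    exact hquad _
  have h2 : (Fintype.card V : ℝ) = ∑ k, (∑ x, U x k) ^ 2 := by
    have h3 := hquad fun _ => 1
    simp only [mul_one, one_mul, hone] at h3
    rw [← h3]
    simp [Matrix.one_apply]
  rw [h1, h2, Finset.mul_sum]
  gcongr with k
  exact hi k (Finset.mem_univ _)

open Classical in
/-- The normalized eigenvalues of a graph: their power sums are the densities of cycles, and the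
largest one is at least the edge density. -/
lemma exists_normalized_eigenvalues [Nonempty V] (G : SimpleGraph V) :
    ∃ μ : V → ℝ, (∀ z, graphPsi G z = ∏ i, (1 - (μ i : ℂ) * z)) ∧ ∑ i, μ i = 0 ∧
      ∑ i, μ i ^ 2 = edgeDensity G ∧ ∑ i, μ i ^ 4 = fourCycleDensity G ∧
      ∃ i, edgeDensity G ≤ μ i := by
  set A := G.adjMatrix ℝ with hAdef
  have hA : A.IsHermitian := by
    rw [Matrix.IsHermitian, Matrix.conjTranspose_eq_transpose_of_trivial]
    exact G.transpose_adjMatrix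
  have hsymm : ∀ x y, A x y = A y x := fun x y => by
    simp [hAdef, SimpleGraph.adjMatrix_apply, G.adj_comm]
  have hN : (0 : ℝ) < Fintype.card V := by exact_mod_cast Fintype.card_pos
  have hNC : (Fintype.card V : ℂ) ≠ 0 := by exact_mod_cast hN.ne'
  set N := (Fintype.card V : ℝ) with hNdef
  refine ⟨fun i => hA.eigenvalues i / N, ?_, ?_, ?_, ?_, ?_⟩
  · intro z
    by_cases hz : z = 0
    · simp [graphPsi, hz]
    · have h1 : G.adjMatrix ℂ = A.map (algebraMap ℝ ℂ) := by
        ext x y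
        simp [hAdef, SimpleGraph.adjMatrix_apply, apply_ite]
      rw [graphPsi, if_neg hz, h1, Matrix.charpoly_map, hA.charpoly_eq, Polynomial.map_prod,
        Polynomial.eval_prod, ← Finset.card_univ, ← Finset.prod_const, ← Finset.prod_inv_distrib,
        ← Finset.prod_mul_distrib]
      refine Finset.prod_congr rfl fun i _ => ?_
      simp [hNdef]
      field_simp
  · rw [← Finset.sum_div]
    have := hA.trace_eq_sum_eigenvalues
    simp only [RCLike.ofReal_real_eq_id, id] at this
    rw [← this, hAdef, SimpleGraph.trace_adjMatrix, zero_div]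
  · simp_rw [div_pow]
    rw [← Finset.sum_div, ← hA.trace_pow_eq_sum_eigenvalues_pow, edgeDensity]
    congr 1
    rw [sq, Matrix.trace]
    refine Finset.sum_congr rfl fun x _ => ?_
    rw [Matrix.diag_apply, Matrix.mul_apply]
    refine Finset.sum_congr rfl fun y _ => ?_
    rw [hsymm y x]
    simp [hAdef, SimpleGraph.adjMatrix_apply]
  · simp_rw [div_pow]
    rw [← Finset.sum_div, ← hA.trace_pow_eq_sum_eigenvalues_pow, fourCycleDensity]
    congr 1
    rw [show 4 = 2 + 2 by rfl, pow_add, sq A, Matrix.trace]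
    refine Finset.sum_congr rfl fun x _ => ?_
    rw [Matrix.diag_apply, Matrix.mul_apply]
    refine Finset.sum_congr rfl fun y _ => ?_
    rw [Matrix.mul_apply, Matrix.mul_apply, sq]
    congr 1
    · exact Finset.sum_congr rfl fun k _ => by rw [hsymm k y]
    · exact Finset.sum_congr rfl fun k _ => by rw [hsymm k x, mul_comm]
  · obtain ⟨i, hi⟩ := hA.exists_sum_le_eigenvalues_mul_card
    refine ⟨i, ?_⟩
    rw [edgeDensity, div_le_div_iff₀ (by positivity) hN, sq, ← mul_assoc]
    gcongr

lemma sum_abs_pow_three_le {ι : Type*} (s : Finset ι) (μ : ι → ℝ) (h : ∑ i ∈ s, μ i ^ 2 ≤ 1) :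
    ∑ i ∈ s, |μ i| ^ 3 ≤ Real.sqrt (∑ i ∈ s, μ i ^ 4) := by
  apply Real.le_sqrt_of_sq_le
  have h1 := Finset.sum_mul_sq_le_sq_mul_sq s (fun i => |μ i|) (fun i => μ i ^ 2)
  have h2 : ∑ i ∈ s, |μ i| ^ 3 = ∑ i ∈ s, |μ i| * μ i ^ 2 :=
    Finset.sum_congr rfl fun i _ => by rw [← sq_abs (μ i)]; ring
  rw [h2]
  refine h1.trans ?_
  simp_rw [sq_abs, ← pow_mul]
  have h3 : 0 ≤ ∑ i ∈ s, μ i ^ (2 * 2) := Finset.sum_nonneg fun i _ => Even.pow_nonneg ⟨2, rfl⟩ _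
  calc _ ≤ 1 * ∑ i ∈ s, μ i ^ (2 * 2) := by gcongr
    _ = _ := by rw [one_mul]

open Classical in
/-- A product over numbers of which all but one are small: the small ones enter only through their
sum and their sum of squares. -/
lemma exists_prod_one_sub_eq {ι : Type*} [Fintype ι] (μ : ι → ℝ) (h0 : ∑ i, μ i = 0)
    {s : ℝ} (hs : ∑ i, μ i ^ 2 = s) (hs1 : s ≤ 1) (i₀ : ι) (z : ℂ)
    (hr : (∑ i, μ i ^ 4 - μ i₀ ^ 4) * ‖z‖ ^ 4 ≤ 1 / 16) :
    ∃ R : ℂ, ∏ i, (1 - (μ i : ℂ) * z) = (1 - μ i₀ * z) *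
        Complex.exp (μ i₀ * z - (s - μ i₀ ^ 2) / 2 * z ^ 2) * R ∧
      ‖R - 1‖ ≤ Real.exp (2 * ‖z‖ ^ 3 * Real.sqrt (∑ i, μ i ^ 4 - μ i₀ ^ 4)) - 1 := by
  set S := Finset.univ.erase i₀ with hS
  have e1 : ∑ i ∈ S, μ i = -μ i₀ := by
    have := Finset.add_sum_erase Finset.univ μ (Finset.mem_univ i₀)
    linarith
  have e2 : ∑ i ∈ S, μ i ^ 2 = s - μ i₀ ^ 2 := by
    have := Finset.add_sum_erase Finset.univ (fun i => μ i ^ 2) (Finset.mem_univ i₀)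
    linarith
  have e4 : ∑ i ∈ S, μ i ^ 4 = ∑ i, μ i ^ 4 - μ i₀ ^ 4 := by
    have := Finset.add_sum_erase Finset.univ (fun i => μ i ^ 4) (Finset.mem_univ i₀)
    linarith
  rw [← e4] at hr ⊢
  have hsmall : ∀ i ∈ S, ‖(μ i : ℂ) * z‖ ≤ 1 / 2 := by
    intro i hi
    have h1 : μ i ^ 4 ≤ ∑ i ∈ S, μ i ^ 4 :=
      Finset.single_le_sum (f := fun i => μ i ^ 4) (fun j _ => by positivity) hi
    refine (pow_le_pow_iff_left₀ (norm_nonneg _) (by norm_num) (by norm_num : 4 ≠ 0)).1 ?_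
    rw [norm_mul, mul_pow, Complex.norm_real, Real.norm_eq_abs, Even.pow_abs ⟨2, rfl⟩]
    refine le_trans (mul_le_mul_of_nonneg_right h1 (by positivity)) (hr.trans (by norm_num))
  set g : ι → ℂ := fun i =>
    (1 - (μ i : ℂ) * z) * Complex.exp ((μ i : ℂ) * z + ((μ i : ℂ) * z) ^ 2 / 2) with hg
  refine ⟨∏ i ∈ S, g i, ?_, ?_⟩
  · rw [← Finset.mul_prod_erase Finset.univ _ (Finset.mem_univ i₀), ← hS, hg,
      Finset.prod_mul_distrib, ← Complex.exp_sum]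
    have h2 : ∑ i ∈ S, ((μ i : ℂ) * z + ((μ i : ℂ) * z) ^ 2 / 2) =
        -(μ i₀ * z - (s - μ i₀ ^ 2) / 2 * z ^ 2) := by
      have e1' : ∑ i ∈ S, (μ i : ℂ) = -(μ i₀ : ℂ) := by exact_mod_cast congrArg Complex.ofReal e1
      have e2' : ∑ i ∈ S, (μ i : ℂ) ^ 2 = (s : ℂ) - (μ i₀ : ℂ) ^ 2 := by
        exact_mod_cast congrArg Complex.ofReal e2
      simp_rw [mul_pow]
      rw [Finset.sum_add_distrib, ← Finset.sum_div, ← Finset.sum_mul, ← Finset.sum_mul, e1', e2']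
      ring
    rw [h2, Complex.exp_neg]
    have := Complex.exp_ne_zero (μ i₀ * z - (s - μ i₀ ^ 2) / 2 * z ^ 2)
    field_simp
  · have h3 : ∏ i ∈ S, g i = ∏ i ∈ S, (1 + (g i - 1)) :=
      Finset.prod_congr rfl fun i _ => by ring
    rw [h3]
    refine (Finset.norm_prod_one_add_sub_one_le S _).trans ?_
    gcongr
    calc ∑ i ∈ S, ‖g i - 1‖ ≤ ∑ i ∈ S, 2 * ‖z‖ ^ 3 * |μ i| ^ 3 := by
          refine Finset.sum_le_sum fun i hi => ?_
          refine (norm_one_sub_mul_exp_add_sq_sub_one_le (hsmall i hi)).trans (le_of_eq ?_)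
          rw [norm_mul, Complex.norm_real, Real.norm_eq_abs]
          ring
      _ = 2 * ‖z‖ ^ 3 * ∑ i ∈ S, |μ i| ^ 3 := by rw [Finset.mul_sum]
      _ ≤ _ := by
          gcongr
          refine sum_abs_pow_three_le S μ ?_
          rw [e2]
          nlinarith [sq_nonneg (μ i₀)]

lemma edgeDensity_le_one (G : SimpleGraph V) : edgeDensity G ≤ 1 := by
  classical
  rw [edgeDensity]
  apply div_le_one_of_le₀ _ (by positivity)
  calc _ ≤ ∑ x : V, ∑ y : V, (1 : ℝ) := by
        gcongr
        rw [SimpleGraph.adjMatrix_apply]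
        split_ifs <;> norm_num
    _ = _ := by simp [sq]

lemma exists_log_graphPsi [Nonempty V] (G : SimpleGraph V) (u : ℝ) (z : ℂ) (hu0 : 0 < u)
    (hu1 : u ≤ 1 / 2) (hz : z ^ 2 = -u) :
    ∃ L : ℝ, graphPsi G z * graphPsi G (-z) = Complex.exp L ∧
      |L - (edgeDensity G * u - fourCycleDensity G * u ^ 2 / 2)| ≤ 2 * u ^ 3 := by
  obtain ⟨μ, hψ, h0, h2, h4, -⟩ := exists_normalized_eigenvalues G
  have hprod : ∀ z, HasProd (fun i => (1 - (μ i : ℂ) * z) * Complex.exp ((μ i : ℂ) * z))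
      (graphPsi G z) := by
    intro z
    have h0' : ∑ i, (μ i : ℂ) = 0 := by exact_mod_cast congrArg Complex.ofReal h0
    convert hasProd_fintype _ using 1
    rw [Finset.prod_mul_distrib, ← Complex.exp_sum, ← Finset.sum_mul, h0', hψ]
    simp
  exact exists_log_mul_of_hasProd (h2 ▸ hasSum_fintype _) (edgeDensity_le_one G)
    (h4 ▸ hasSum_fintype _) hu0.le hu1 hz (hprod z) (hprod (-z))

lemma abs_fourCycleDensity_le_one [Nonempty V] (G : SimpleGraph V) : |fourCycleDensity G| ≤ 1 := by
  obtain ⟨μ, hψ, h0, h2, h4, -⟩ := exists_normalized_eigenvalues G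
  have h1 := edgeDensity_le_one G
  rw [← h2] at h1
  rw [← h4, abs_of_nonneg (Finset.sum_nonneg fun i _ => by positivity)]
  refine le_trans (Finset.sum_le_sum fun i _ => ?_) h1
  have h3 : μ i ^ 2 ≤ 1 := (Finset.single_le_sum (f := fun i => μ i ^ 2)
    (fun j _ => sq_nonneg _) (Finset.mem_univ i)).trans h1
  nlinarith [sq_nonneg (μ i)]

end FiniteGraph

section Sequence

variable {V : ℕ → Type*} [∀ n, Fintype (V n)]

lemma eventually_nonempty (hV : Tendsto (fun n => Fintype.card (V n)) atTop atTop) :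
    ∀ᶠ n in atTop, Nonempty (V n) := by
  filter_upwards [hV.eventually_gt_atTop 0] with n hn using Fintype.card_pos_iff.1 hn

theorem tendsto_densities_of_tendsto_graphPsi (G : ∀ n, SimpleGraph (V n))
    (hV : Tendsto (fun n => Fintype.card (V n)) atTop atTop) {p : ℝ} (hp : p ∈ Set.Icc (0 : ℝ) 1)
    (h : ∀ z, Tendsto (fun n => graphPsi (G n) z) atTop (𝓝 (quasiPsi p z))) :
    Tendsto (fun n => edgeDensity (G n)) atTop (𝓝 p) ∧
      Tendsto (fun n => fourCycleDensity (G n)) atTop (𝓝 (p ^ 4)) := by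
  have hne := eventually_nonempty hV
  refine tendsto_coeffs_of_tendsto_mul (ψ := fun n => graphPsi (G n)) hp ?_ ?_ h
  · filter_upwards [hne] with n hn using abs_fourCycleDensity_le_one (G n)
  · filter_upwards [hne] with n hn u z hu0 hu1 hz using exists_log_graphPsi (G n) u z hu0 hu1 hz

/-- One normalized eigenvalue tends to `p`; the fourth powers of the others, and hence the others
themselves, tend to `0`. -/
theorem tendsto_graphPsi_of_tendsto_densities (G : ∀ n, SimpleGraph (V n))
    (hV : Tendsto (fun n => Fintype.card (V n)) atTop atTop) {p : ℝ} (hp : p ∈ Set.Icc (0 : ℝ) 1)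
    (he : Tendsto (fun n => edgeDensity (G n)) atTop (𝓝 p))
    (hc : Tendsto (fun n => fourCycleDensity (G n)) atTop (𝓝 (p ^ 4))) (z : ℂ) :
    Tendsto (fun n => graphPsi (G n) z) atTop (𝓝 (quasiPsi p z)) := by
  have hex : ∀ᶠ n in atTop, ∃ mR : ℝ × ℂ, edgeDensity (G n) ≤ mR.1 ∧
      mR.1 ^ 4 ≤ fourCycleDensity (G n) ∧
      ((fourCycleDensity (G n) - mR.1 ^ 4) * ‖z‖ ^ 4 ≤ 1 / 16 →
        graphPsi (G n) z = (1 - mR.1 * z) *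
          Complex.exp (mR.1 * z - (edgeDensity (G n) - mR.1 ^ 2) / 2 * z ^ 2) * mR.2 ∧
        ‖mR.2 - 1‖ ≤
          Real.exp (2 * ‖z‖ ^ 3 * Real.sqrt (fourCycleDensity (G n) - mR.1 ^ 4)) - 1) := by
    filter_upwards [eventually_nonempty hV] with n hn
    obtain ⟨μ, hψ, h0, h2, h4, i₀, hi⟩ := exists_normalized_eigenvalues (G n)
    have hle : μ i₀ ^ 4 ≤ fourCycleDensity (G n) := by
      rw [← h4]
      exact Finset.single_le_sum (f := fun i => μ i ^ 4) (fun j _ => by positivity)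
        (Finset.mem_univ i₀)
    by_cases hr : (fourCycleDensity (G n) - μ i₀ ^ 4) * ‖z‖ ^ 4 ≤ 1 / 16
    · obtain ⟨R, hR1, hR2⟩ := exists_prod_one_sub_eq μ h0 h2 (edgeDensity_le_one _) i₀ z
        (h4.symm ▸ hr)
      rw [h4] at hR2
      exact ⟨(μ i₀, R), hi, hle, fun _ => ⟨(hψ z).trans hR1, hR2⟩⟩
    · exact ⟨(μ i₀, 0), hi, hle, fun h => absurd h hr⟩
  obtain ⟨mR, hmR⟩ := hex.choice
  -- `m` lies between the edge density and the fourth root of the density of four-cycles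
  have hm : Tendsto (fun n => (mR n).1) atTop (𝓝 p) := by
    have h1 : Tendsto (fun n => Real.sqrt (Real.sqrt (fourCycleDensity (G n)))) atTop (𝓝 p) := by
      have := hc.sqrt.sqrt
      rwa [show p ^ 4 = (p ^ 2) ^ 2 by ring, Real.sqrt_sq (sq_nonneg p), Real.sqrt_sq hp.1] at this
    refine tendsto_of_tendsto_of_tendsto_of_le_of_le' he h1 ?_ ?_
    · filter_upwards [hmR] with n hn using hn.1
    · filter_upwards [hmR] with n hn
      apply Real.le_sqrt_of_sq_le
      apply Real.le_sqrt_of_sq_le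
      rw [← pow_mul]
      exact hn.2.1
  have hr : Tendsto (fun n => fourCycleDensity (G n) - (mR n).1 ^ 4) atTop (𝓝 0) := by
    simpa using hc.sub (hm.pow 4)
  have hsmall : ∀ᶠ n in atTop, (fourCycleDensity (G n) - (mR n).1 ^ 4) * ‖z‖ ^ 4 ≤ 1 / 16 := by
    have := hr.mul_const (‖z‖ ^ 4)
    rw [zero_mul] at this
    exact this.eventually_le_const (by norm_num)
  have hR : Tendsto (fun n => (mR n).2) atTop (𝓝 1) := by
    rw [tendsto_iff_norm_sub_tendsto_zero]
    have h1 : Tendsto (fun n => Real.exp (2 * ‖z‖ ^ 3 *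
        Real.sqrt (fourCycleDensity (G n) - (mR n).1 ^ 4)) - 1) atTop (𝓝 0) := by
      have := ((hr.sqrt.const_mul (2 * ‖z‖ ^ 3)).rexp).sub_const 1
      simpa using this
    refine squeeze_zero' (Eventually.of_forall fun n => norm_nonneg _) ?_ h1
    filter_upwards [hmR, hsmall] with n hn hs using (hn.2.2 hs).2
  have hmC : Tendsto (fun n => ((mR n).1 : ℂ)) atTop (𝓝 (p : ℂ)) :=
    (Complex.continuous_ofReal.tendsto p).comp hm
  have heC : Tendsto (fun n => (edgeDensity (G n) : ℂ)) atTop (𝓝 (p : ℂ)) :=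
    (Complex.continuous_ofReal.tendsto p).comp he
  have hlim : Tendsto (fun n => (1 - (mR n).1 * z) * Complex.exp ((mR n).1 * z -
      (edgeDensity (G n) - (mR n).1 ^ 2) / 2 * z ^ 2) * (mR n).2) atTop
      (𝓝 ((1 - p * z) * Complex.exp (p * z - (p - p ^ 2) / 2 * z ^ 2) * 1)) :=
    (((hmC.mul_const z).const_sub 1).mul (((hmC.mul_const z).sub
      (((heC.sub (hmC.pow 2)).div_const 2).mul_const (z ^ 2))).cexp)).mul hR
  have hval : quasiPsi p z =
      (1 - p * z) * Complex.exp (p * z - (p - p ^ 2) / 2 * z ^ 2) * 1 := by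
    rw [quasiPsi, mul_one]
    congr 2
    ring
  rw [hval]
  refine hlim.congr' ?_
  filter_upwards [hmR, hsmall] with n hn hs using ((hn.2.2 hs).1).symm

end Sequence

/-! ### Homomorphism counts and four-cycles -/

open Classical in
/-- The edges of a graph on `Fin s`, as increasing pairs. -/
noncomputable def edgePairs {s : ℕ} (F : SimpleGraph (Fin s)) : Finset (Fin s × Fin s) :=
  Finset.univ.filter fun e => e.1 < e.2 ∧ F.Adj e.1 e.2

lemma mem_edgePairs {s : ℕ} {F : SimpleGraph (Fin s)} {e : Fin s × Fin s} :
    e ∈ edgePairs F ↔ e.1 < e.2 ∧ F.Adj e.1 e.2 := by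
  simp [edgePairs]

lemma card_edgePairs {s : ℕ} (F : SimpleGraph (Fin s)) : (edgePairs F).card = F.edgeSet.ncard := by
  have h : F.edgeSet = (fun e : Fin s × Fin s => s(e.1, e.2)) '' (edgePairs F : Set _) := by
    ext x
    induction x using Sym2.ind with
    | _ i j =>
      simp only [SimpleGraph.mem_edgeSet, Set.mem_image, Finset.mem_coe, mem_edgePairs, Prod.exists]
      constructor
      · intro hij
        rcases lt_or_gt_of_ne hij.ne with hlt | hlt
        · exact ⟨i, j, ⟨hlt, hij⟩, rfl⟩
        · exact ⟨j, i, ⟨hlt, hij.symm⟩, Sym2.eq_swap⟩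
      · rintro ⟨a, b, ⟨-, hab⟩, he⟩
        rcases Sym2.eq_iff.1 he with ⟨rfl, rfl⟩ | ⟨rfl, rfl⟩
        · exact hab
        · exact hab.symm
  rw [h, Set.InjOn.ncard_image, Set.ncard_coe_finset]
  rintro ⟨a, b⟩ hab ⟨c, d⟩ hcd he
  rw [Finset.mem_coe, mem_edgePairs] at hab hcd
  rcases Sym2.eq_iff.1 he with ⟨h1, h2⟩ | ⟨h1, h2⟩
  · exact Prod.ext h1 h2
  · obtain rfl : a = d := h1
    obtain rfl : b = c := h2
    exact absurd hab.1 hcd.1.not_gt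

section HomCount

variable {V : Type*} [Fintype V]

open Classical in
lemma card_hom_eq_sum {s : ℕ} (F : SimpleGraph (Fin s)) (G : SimpleGraph V) :
    (Nat.card (F →g G) : ℝ) =
      ∑ x : Fin s → V, ∏ e ∈ edgePairs F, G.adjMatrix ℝ (x e.1) (x e.2) := by
  have hind : ∀ x : Fin s → V, ∏ e ∈ edgePairs F, G.adjMatrix ℝ (x e.1) (x e.2) =
      if ∀ i j, F.Adj i j → G.Adj (x i) (x j) then 1 else 0 := by
    intro x
    split_ifs with h
    · refine Finset.prod_eq_one fun e he => ?_
      rw [SimpleGraph.adjMatrix_apply, if_pos (h _ _ (mem_edgePairs.1 he).2)]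
    · push Not at h
      obtain ⟨i, j, hij, hG⟩ := h
      rcases lt_or_gt_of_ne hij.ne with hlt | hlt
      · refine Finset.prod_eq_zero (mem_edgePairs.2 ⟨hlt, hij⟩ : (i, j) ∈ _) ?_
        rw [SimpleGraph.adjMatrix_apply, if_neg hG]
      · refine Finset.prod_eq_zero (mem_edgePairs.2 ⟨hlt, hij.symm⟩ : (j, i) ∈ _) ?_
        rw [SimpleGraph.adjMatrix_apply, if_neg fun h => hG h.symm]
  have heq : (F →g G) ≃ {x : Fin s → V // ∀ i j, F.Adj i j → G.Adj (x i) (x j)} :=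
    { toFun := fun f => ⟨f, fun i j h => f.map_adj h⟩
      invFun := fun x => ⟨x.1, fun {i j} h => x.2 i j h⟩
      left_inv := fun f => rfl
      right_inv := fun x => rfl }
  simp_rw [hind]
  rw [Nat.card_congr heq, Nat.card_eq_fintype_card, Fintype.card_subtype, Finset.sum_boole]

/-- Resampling one coordinate does not change the sum over all maps. -/
lemma sum_sum_update {ι : Type*} [Fintype ι] [DecidableEq ι] (g : (ι → V) → ℝ) (i : ι) :
    ∑ x : ι → V, ∑ a : V, g (Function.update x i a) = Fintype.card V * ∑ x, g x := by
  have h : ∑ q : (ι → V) × V, g (Function.update q.1 i q.2) = ∑ q : (ι → V) × V, g q.1 := by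
    -- exchanging the new value with the old one is an involution
    refine Fintype.sum_equiv
      { toFun := fun q => (Function.update q.1 i q.2, q.1 i)
        invFun := fun q => (Function.update q.1 i q.2, q.1 i)
        left_inv := fun q => by simp
        right_inv := fun q => by simp } _ _ fun q => rfl
  rw [Fintype.sum_prod_type, Fintype.sum_prod_type] at h
  rw [h, Finset.mul_sum]
  simp

lemma sum_fun_succ {n : ℕ} (g : (Fin (n + 1) → V) → ℝ) :
    ∑ x, g x = ∑ a, ∑ x : Fin n → V, g (Fin.cons a x) := by
  rw [← Fintype.sum_prod_type']
  exact ((Fin.consEquiv fun _ => V).sum_comp g).symm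

open Classical in
lemma edgePairs_top_two : edgePairs (⊤ : SimpleGraph (Fin 2)) = {(0, 1)} := by
  ext ⟨i, j⟩
  rw [mem_edgePairs]
  fin_cases i <;> fin_cases j <;> simp

open Classical in
lemma edgePairs_cycleGraph_four :
    edgePairs (SimpleGraph.cycleGraph 4) = {(0, 1), (1, 2), (2, 3), (0, 3)} := by
  ext ⟨i, j⟩
  rw [mem_edgePairs]
  revert i j
  simp only [SimpleGraph.cycleGraph_adj, Finset.mem_insert, Finset.mem_singleton]
  decide

lemma homDensity_top_two (G : SimpleGraph V) :
    homDensity (⊤ : SimpleGraph (Fin 2)) G = edgeDensity G := by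
  rw [homDensity, edgeDensity, card_hom_eq_sum, edgePairs_top_two]
  congr 1
  simp_rw [Finset.prod_singleton]
  rw [sum_fun_succ]
  refine Finset.sum_congr rfl fun a _ => ?_
  rw [sum_fun_succ]
  refine Finset.sum_congr rfl fun b _ => ?_
  rw [Fintype.sum_unique]
  rfl

lemma homDensity_cycleGraph_four (G : SimpleGraph V) :
    homDensity (SimpleGraph.cycleGraph 4) G = fourCycleDensity G := by
  classical
  rw [homDensity, fourCycleDensity, card_hom_eq_sum, edgePairs_cycleGraph_four]
  have hsymm : ∀ x y, G.adjMatrix ℝ x y = G.adjMatrix ℝ y x := fun x y => by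
    simp [SimpleGraph.adjMatrix_apply, G.adj_comm]
  have hprod : ∀ x : Fin 4 → V, ∏ e ∈ ({(0, 1), (1, 2), (2, 3), (0, 3)} : Finset (Fin 4 × Fin 4)),
      G.adjMatrix ℝ (x e.1) (x e.2) = (G.adjMatrix ℝ (x 0) (x 1) * G.adjMatrix ℝ (x 2) (x 1)) *
        (G.adjMatrix ℝ (x 0) (x 3) * G.adjMatrix ℝ (x 2) (x 3)) := by
    intro x
    rw [Finset.prod_insert (by decide), Finset.prod_insert (by decide),
      Finset.prod_insert (by decide), Finset.prod_singleton, hsymm (x 1) (x 2)]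
    ring
  congr 1
  simp_rw [hprod]
  rw [sum_fun_succ]
  refine Finset.sum_congr rfl fun a _ => ?_
  simp_rw [sum_fun_succ]
  rw [Finset.sum_comm]
  refine Finset.sum_congr rfl fun c _ => ?_
  rw [sq, Finset.sum_mul_sum]
  refine Finset.sum_congr rfl fun b _ => Finset.sum_congr rfl fun d _ => ?_
  rw [Fintype.sum_unique]
  rfl

/-- A density of four-cycles close to its quasi-random value makes the entries of `w - p` cancel on
all rectangles. -/
lemma sum_sub_mul_mul_pow_four_le (w : V → V → ℝ) (hw : ∀ x y, w x y = w y x) (p e c : ℝ)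
    (he : ∑ x, ∑ y, w x y = e * (Fintype.card V : ℝ) ^ 2)
    (hc : ∑ x, ∑ x', (∑ y, w x y * w x' y) ^ 2 = c * (Fintype.card V : ℝ) ^ 4)
    (u v : V → ℝ) (hu : ∀ x, |u x| ≤ 1) (hv : ∀ x, |v x| ≤ 1) :
    (∑ x, ∑ y, (w x y - p) * (u x * v y)) ^ 4 ≤
      3 * (c + 3 * p ^ 4 - 4 * p ^ 3 * e) * (Fintype.card V : ℝ) ^ 8 := by
  set N := (Fintype.card V : ℝ) with hN
  have hN0 : 0 ≤ N := Nat.cast_nonneg _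
  -- the codegrees of `w - p`; those of `w` are `k`, and its degrees are `d`
  set K : V → V → ℝ := fun x x' => ∑ y, (w x y - p) * (w x' y - p) with hK
  set d : V → ℝ := fun x => ∑ y, w x y with hd
  set k : V → V → ℝ := fun x x' => ∑ y, w x y * w x' y with hk
  set S : ℝ := ∑ x, ∑ x', k x x' with hS
  have hN1 : ∑ _x : V, (1 : ℝ) = N := by simp [hN]
  have hsq1 : ∀ t : ℝ, |t| ≤ 1 → t ^ 2 ≤ 1 := fun t ht => by
    rw [← sq_abs]
    exact pow_le_one₀ (abs_nonneg _) ht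
  have hKk : ∀ x x', K x x' = (k x x' - p ^ 2 * N) - p * (d x - p * N) - p * (d x' - p * N) := by
    intro x x'
    have h : ∀ y, (w x y - p) * (w x' y - p) =
        w x y * w x' y - p * w x y - p * w x' y + p ^ 2 * 1 := fun y => by ring
    simp only [hK, hk, hd, h, Finset.sum_add_distrib, Finset.sum_sub_distrib, ← Finset.mul_sum,
      hN1]
    ring
  have hSd : S = ∑ x, d x ^ 2 := by
    simp only [hS, hk]
    calc _ = ∑ x, ∑ y, ∑ x', w x y * w x' y :=
          Finset.sum_congr rfl fun x _ => Finset.sum_comm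
      _ = ∑ y, ∑ x, ∑ x', w x y * w x' y := Finset.sum_comm
      _ = _ := by
          refine Finset.sum_congr rfl fun y _ => ?_
          rw [sq, Finset.sum_mul_sum]
          exact Finset.sum_congr rfl fun x _ => Finset.sum_congr rfl fun x' _ => by
            rw [hw x y, hw x' y]
  have hk2 : ∑ x, ∑ x', (k x x' - p ^ 2 * N) ^ 2 =
      c * N ^ 4 - 2 * p ^ 2 * N * S + p ^ 4 * N ^ 4 := by
    have h : ∀ x x', (k x x' - p ^ 2 * N) ^ 2 =
        k x x' ^ 2 - 2 * p ^ 2 * N * k x x' + p ^ 4 * N ^ 2 * 1 := fun x x' => by ring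
    simp only [h, Finset.sum_add_distrib, Finset.sum_sub_distrib, ← Finset.mul_sum, hN1]
    have h1 : ∑ _x : V, N = N * N := by
      rw [← hN1, Finset.sum_mul_sum]
      simp
    rw [h1, ← hc]
    ring
  have hd2 : ∑ x, (d x - p * N) ^ 2 = S - 2 * p * e * N ^ 3 + p ^ 2 * N ^ 3 := by
    have h : ∀ x, (d x - p * N) ^ 2 = d x ^ 2 - 2 * p * N * d x + p ^ 2 * N ^ 2 * 1 :=
      fun x => by ring
    simp only [h, Finset.sum_add_distrib, Finset.sum_sub_distrib, ← Finset.mul_sum, hN1, hSd]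
    rw [show ∑ x, d x = e * N ^ 2 from he]
    ring
  -- the sum `S` of the codegrees, which is not among the data, cancels
  have hK2 : ∑ x, ∑ x', K x x' ^ 2 ≤ 3 * (c + 3 * p ^ 4 - 4 * p ^ 3 * e) * N ^ 4 := by
    calc ∑ x, ∑ x', K x x' ^ 2 ≤ ∑ x, ∑ x', (3 * (k x x' - p ^ 2 * N) ^ 2 +
          3 * p ^ 2 * (d x - p * N) ^ 2 * 1 + 3 * p ^ 2 * (d x' - p * N) ^ 2) := by
          refine Finset.sum_le_sum fun x _ => Finset.sum_le_sum fun x' _ => ?_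
          rw [hKk]
          nlinarith [sq_nonneg ((k x x' - p ^ 2 * N) + p * (d x - p * N)),
            sq_nonneg ((k x x' - p ^ 2 * N) + p * (d x' - p * N)),
            sq_nonneg (p * (d x - p * N) - p * (d x' - p * N))]
      _ = 3 * (c + 3 * p ^ 4 - 4 * p ^ 3 * e) * N ^ 4 := by
          simp only [Finset.sum_add_distrib, ← Finset.mul_sum, hN1, hk2, ← Finset.sum_mul, hd2,
            Finset.sum_const, Finset.card_univ, nsmul_eq_mul, ← hN]
          ring
  have h1 : (∑ x, ∑ y, (w x y - p) * (u x * v y)) ^ 2 ≤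
      N * ∑ y, (∑ x, (w x y - p) * u x) ^ 2 := by
    have h : ∑ x, ∑ y, (w x y - p) * (u x * v y) = ∑ y, v y * ∑ x, (w x y - p) * u x := by
      rw [Finset.sum_comm]
      refine Finset.sum_congr rfl fun y _ => ?_
      rw [Finset.mul_sum]
      exact Finset.sum_congr rfl fun x _ => by ring
    rw [h]
    refine (Finset.sum_mul_sq_le_sq_mul_sq _ _ _).trans ?_
    gcongr
    rw [← hN1]
    exact Finset.sum_le_sum fun y _ => hsq1 _ (hv y)
  have h2 : ∑ y, (∑ x, (w x y - p) * u x) ^ 2 ≤ ∑ q : V × V, |K q.1 q.2| := by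
    have h : ∑ y, (∑ x, (w x y - p) * u x) ^ 2 = ∑ x, ∑ x', (u x * u x') * K x x' := by
      simp only [sq, Finset.sum_mul_sum]
      simp only [hK, Finset.mul_sum]
      rw [Finset.sum_comm]
      refine Finset.sum_congr rfl fun x _ => ?_
      rw [Finset.sum_comm]
      exact Finset.sum_congr rfl fun x' _ => Finset.sum_congr rfl fun y _ => by ring
    rw [h, Fintype.sum_prod_type]
    refine Finset.sum_le_sum fun x _ => Finset.sum_le_sum fun x' _ => ?_
    refine (le_abs_self _).trans ?_
    rw [abs_mul, abs_mul]
    have : |u x| * |u x'| ≤ 1 := mul_le_one₀ (hu x) (abs_nonneg _) (hu x')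
    nlinarith [abs_nonneg (K x x')]
  have h3 : (∑ q : V × V, |K q.1 q.2|) ^ 2 ≤ N ^ 2 * ∑ x, ∑ x', K x x' ^ 2 := by
    have h := sq_sum_le_card_mul_sum_sq (s := Finset.univ) (f := fun q : V × V => |K q.1 q.2|)
    simp only [sq_abs] at h
    rw [Fintype.sum_prod_type (fun q : V × V => K q.1 q.2 ^ 2), Finset.card_univ,
      Fintype.card_prod, Nat.cast_mul] at h
    rw [sq N]
    exact h
  have h0 : 0 ≤ ∑ y, (∑ x, (w x y - p) * u x) ^ 2 := Finset.sum_nonneg fun y _ => sq_nonneg _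
  calc _ = ((∑ x, ∑ y, (w x y - p) * (u x * v y)) ^ 2) ^ 2 := by ring
    _ ≤ (N * ∑ y, (∑ x, (w x y - p) * u x) ^ 2) ^ 2 := by gcongr
    _ = N ^ 2 * (∑ y, (∑ x, (w x y - p) * u x) ^ 2) ^ 2 := by ring
    _ ≤ N ^ 2 * (∑ q : V × V, |K q.1 q.2|) ^ 2 := by gcongr
    _ ≤ N ^ 2 * (N ^ 2 * (3 * (c + 3 * p ^ 4 - 4 * p ^ 3 * e) * N ^ 4)) := by
        gcongr
        exact h3.trans (by gcongr)
    _ = _ := by ring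

/-- The contribution of a single edge `(i, j)` to a homomorphism count, all other edges being
weighted by `w`: fixing all vertices but `i` and `j` leaves a sum over a product of functions of one
variable each. -/
lemma abs_sum_sub_mul_prod_le (w : V → V → ℝ) (hw : ∀ x y, |w x y| ≤ 1) {p ε : ℝ}
    (hcut : ∀ u v : V → ℝ, (∀ x, |u x| ≤ 1) → (∀ x, |v x| ≤ 1) →
      |∑ x, ∑ y, (w x y - p) * (u x * v y)| ≤ ε * (Fintype.card V : ℝ) ^ 2) {s : ℕ}
    (D : Finset (Fin s × Fin s)) (hD : ∀ e ∈ D, e.1 < e.2) (i j : Fin s) (hij : i < j)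
    (hijD : (i, j) ∉ D) :
    |∑ x : Fin s → V, (w (x i) (x j) - p) * ∏ e ∈ D, w (x e.1) (x e.2)| ≤
      ε * (Fintype.card V : ℝ) ^ s := by
  set N := (Fintype.card V : ℝ) with hN
  rcases isEmpty_or_nonempty V with hV | hV
  · have hs : IsEmpty (Fin s → V) := ⟨fun x => hV.elim (x i)⟩
    have hs0 : s ≠ 0 := fun h => by subst h; exact i.elim0
    simp [hN, hs0]
  have hN0 : 0 < N := by
    rw [hN]
    exact_mod_cast Fintype.card_pos
  set g : (Fin s → V) → ℝ := fun x => (w (x i) (x j) - p) * ∏ e ∈ D, w (x e.1) (x e.2) with hg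
  have hres : N ^ 2 * ∑ x, g x =
      ∑ x : Fin s → V, ∑ a, ∑ b, g (Function.update (Function.update x i a) j b) := by
    rw [sum_sum_update (fun x => ∑ b, g (Function.update x j b)) i, sum_sum_update g j, ← hN]
    ring
  have hone : ∀ x : Fin s → V,
      |∑ a, ∑ b, g (Function.update (Function.update x i a) j b)| ≤ ε * N ^ 2 := by
    intro x
    -- no edge of `D` contains both `i` and `j`, so each factor depends on `a` or on `b` alone
    set u : V → ℝ := fun a => ∏ e ∈ D with e.1 ≠ j ∧ e.2 ≠ j,
      w (Function.update x i a e.1) (Function.update x i a e.2) with hu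
    set v : V → ℝ := fun b => ∏ e ∈ D with ¬(e.1 ≠ j ∧ e.2 ≠ j),
      w (Function.update x j b e.1) (Function.update x j b e.2) with hv
    have hguv : ∀ a b, g (Function.update (Function.update x i a) j b) =
        (w a b - p) * (u a * v b) := by
      intro a b
      have hi : Function.update (Function.update x i a) j b i = a := by
        rw [Function.update_of_ne hij.ne, Function.update_self]
      have hj : Function.update (Function.update x i a) j b j = b := Function.update_self _ _ _
      simp only [hg, hi, hj]
      rw [← Finset.prod_filter_mul_prod_filter_not D fun e => e.1 ≠ j ∧ e.2 ≠ j]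
      congr 2
      · refine Finset.prod_congr rfl fun e he => ?_
        obtain ⟨-, h1, h2⟩ := Finset.mem_filter.1 he
        rw [Function.update_of_ne h1, Function.update_of_ne h2]
      · refine Finset.prod_congr rfl fun e he => ?_
        obtain ⟨heD, h1⟩ := Finset.mem_filter.1 he
        have hlt := hD e heD
        have h2 : e.1 ≠ i ∧ e.2 ≠ i := by
          constructor
          · rintro h
            refine hijD ?_
            have : e.2 = j := by
              by_contra hne
              exact h1 ⟨h ▸ hij.ne, hne⟩
            rw [← h, ← this]
            exact heD
          · rintro h
            refine h1 ⟨?_, h ▸ hij.ne⟩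
            exact (hlt.trans (h ▸ hij)).ne
        rw [Function.update_comm hij.ne, Function.update_of_ne h2.1, Function.update_of_ne h2.2]
    simp_rw [hguv]
    have hle : ∀ (D' : Finset (Fin s × Fin s)) (y : Fin s → V),
        |∏ e ∈ D', w (y e.1) (y e.2)| ≤ 1 := fun D' y => by
      rw [Finset.abs_prod]
      exact Finset.prod_le_one (fun _ _ => abs_nonneg _) fun _ _ => hw _ _
    exact hcut u v (fun a => hle _ _) fun b => hle _ _
  have hfin : N ^ 2 * |∑ x, g x| ≤ N ^ 2 * (ε * N ^ s) := by
    rw [← abs_of_pos (by positivity : 0 < N ^ 2), ← abs_mul, abs_of_pos (by positivity : 0 < N ^ 2),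
      hres]
    refine (Finset.abs_sum_le_sum_abs _ _).trans ((Finset.sum_le_sum fun x _ => hone x).trans ?_)
    rw [Finset.sum_const, Finset.card_univ, Fintype.card_fun, Fintype.card_fin, nsmul_eq_mul]
    push_cast
    rw [← hN]
    exact le_of_eq (by ring)
  exact le_of_mul_le_mul_left hfin (by positivity)

/-- The counting lemma: replace the edges by `p` one at a time. -/
lemma abs_sum_prod_sub_le (w : V → V → ℝ) (hw : ∀ x y, |w x y| ≤ 1) {p ε : ℝ}
    (hp : p ∈ Set.Icc (0 : ℝ) 1)
    (hcut : ∀ u v : V → ℝ, (∀ x, |u x| ≤ 1) → (∀ x, |v x| ≤ 1) →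
      |∑ x, ∑ y, (w x y - p) * (u x * v y)| ≤ ε * (Fintype.card V : ℝ) ^ 2) {s : ℕ}
    (D : Finset (Fin s × Fin s)) (hD : ∀ e ∈ D, e.1 < e.2) :
    |∑ x : Fin s → V, ∏ e ∈ D, w (x e.1) (x e.2) - p ^ D.card * (Fintype.card V : ℝ) ^ s| ≤
      D.card * (ε * (Fintype.card V : ℝ) ^ s) := by
  induction D using Finset.induction_on with
  | empty => simp
  | insert e D he ih =>
    have ih' := ih fun e' he' => hD e' (Finset.mem_insert_of_mem he')
    have h1 := abs_sum_sub_mul_prod_le w hw hcut D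
      (fun e' he' => hD e' (Finset.mem_insert_of_mem he')) e.1 e.2
      (hD e (Finset.mem_insert_self _ _)) he
    have h2 : ∑ x : Fin s → V, ∏ e' ∈ insert e D, w (x e'.1) (x e'.2) -
        p ^ (insert e D).card * (Fintype.card V : ℝ) ^ s =
        ∑ x : Fin s → V, (w (x e.1) (x e.2) - p) * ∏ e' ∈ D, w (x e'.1) (x e'.2) +
        p * (∑ x : Fin s → V, ∏ e' ∈ D, w (x e'.1) (x e'.2) -
          p ^ D.card * (Fintype.card V : ℝ) ^ s) := by
      simp_rw [Finset.prod_insert he, sub_mul, Finset.sum_sub_distrib, ← Finset.mul_sum]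
      rw [Finset.card_insert_of_notMem he]
      ring
    rw [h2]
    refine (abs_add_le _ _).trans ?_
    rw [abs_mul, abs_of_nonneg hp.1, Finset.card_insert_of_notMem he]
    have h3 := mul_le_of_le_one_left (abs_nonneg (∑ x : Fin s → V, ∏ e' ∈ D, w (x e'.1) (x e'.2) -
          p ^ D.card * (Fintype.card V : ℝ) ^ s)) hp.2
    push_cast
    linarith

lemma abs_homDensity_sub_le [Nonempty V] (G : SimpleGraph V) {p : ℝ} (hp : p ∈ Set.Icc (0 : ℝ) 1)
    {s : ℕ} (F : SimpleGraph (Fin s)) :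
    |homDensity F G - p ^ F.edgeSet.ncard| ≤ F.edgeSet.ncard * Real.sqrt (Real.sqrt
      (3 * (fourCycleDensity G + 3 * p ^ 4 - 4 * p ^ 3 * edgeDensity G))) := by
  classical
  set δ := 3 * (fourCycleDensity G + 3 * p ^ 4 - 4 * p ^ 3 * edgeDensity G) with hδ
  have hN0 : (0 : ℝ) < Fintype.card V := by exact_mod_cast Fintype.card_pos
  set w : V → V → ℝ := fun x y => G.adjMatrix ℝ x y with hw
  have hsymm : ∀ x y, w x y = w y x := fun x y => by
    simp [hw, SimpleGraph.adjMatrix_apply, G.adj_comm]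
  have hw1 : ∀ x y, |w x y| ≤ 1 := fun x y => by
    simp only [hw, SimpleGraph.adjMatrix_apply]
    split_ifs <;> simp
  have hcut : ∀ u v : V → ℝ, (∀ x, |u x| ≤ 1) → (∀ x, |v x| ≤ 1) →
      |∑ x, ∑ y, (w x y - p) * (u x * v y)| ≤
        Real.sqrt (Real.sqrt δ) * (Fintype.card V : ℝ) ^ 2 := by
    intro u v hu hv
    have h := sum_sub_mul_mul_pow_four_le w hsymm p (edgeDensity G) (fourCycleDensity G)
      (by rw [edgeDensity]; field_simp; rfl) (by rw [fourCycleDensity]; field_simp; rfl) u v hu hv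
    rw [← hδ] at h
    set X := ∑ x, ∑ y, (w x y - p) * (u x * v y) with hX
    have h8 : Real.sqrt (Real.sqrt (δ * (Fintype.card V : ℝ) ^ 8)) =
        Real.sqrt (Real.sqrt δ) * (Fintype.card V : ℝ) ^ 2 := by
      rw [Real.sqrt_mul' _ (by positivity), show (Fintype.card V : ℝ) ^ 8 =
        ((Fintype.card V : ℝ) ^ 4) ^ 2 by ring, Real.sqrt_sq (by positivity),
        Real.sqrt_mul' _ (by positivity), show (Fintype.card V : ℝ) ^ 4 =
        ((Fintype.card V : ℝ) ^ 2) ^ 2 by ring, Real.sqrt_sq (by positivity)]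
    rw [← h8]
    apply Real.le_sqrt_of_sq_le
    apply Real.le_sqrt_of_sq_le
    rw [sq_abs, ← pow_mul]
    exact h
  have h := abs_sum_prod_sub_le w hw1 hp hcut (edgePairs F) fun e he => (mem_edgePairs.1 he).1
  rw [← card_hom_eq_sum, card_edgePairs] at h
  have hNs : (0 : ℝ) < (Fintype.card V : ℝ) ^ s := by positivity
  have h2 : homDensity F G - p ^ F.edgeSet.ncard = (Nat.card (F →g G) -
      p ^ F.edgeSet.ncard * (Fintype.card V : ℝ) ^ s) / (Fintype.card V : ℝ) ^ s := by
    rw [homDensity]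
    field_simp
  rw [h2, abs_div, abs_of_pos hNs, div_le_iff₀ hNs, mul_assoc]
  exact h

open Classical in
lemma card_filter_eq_mul_card {s : ℕ} {i j : Fin s} (hij : i ≠ j) :
    (Fintype.card V : ℝ) * (Finset.univ.filter fun x : Fin s → V => x i = x j).card =
      (Fintype.card V : ℝ) ^ s := by
  have h := sum_sum_update (fun x : Fin s → V => if x i = x j then (1 : ℝ) else 0) i
  rw [Finset.sum_boole] at h
  rw [← h]
  simp [Function.update_of_ne hij.symm]

/-- All but a fraction `O(1 / |V|)` of the maps into `V` are injective. -/
lemma abs_homDensity_sub_copyDensity_le [Nonempty V] (G : SimpleGraph V) {s : ℕ}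
    (F : SimpleGraph (Fin s)) :
    |homDensity F G - copyDensity F G| ≤ (s : ℝ) ^ 2 / Fintype.card V := by
  classical
  have hN0 : (0 : ℝ) < Fintype.card V := by exact_mod_cast Fintype.card_pos
  have hcopy : G.labelledCopyCount F = Nat.card {f : F →g G // Function.Injective f} := by
    refine Fintype.card_eq_nat_card.trans (Nat.card_congr ?_)
    exact
      { toFun := fun f => ⟨f.toHom, f.injective⟩
        invFun := fun f => ⟨f.1, f.2⟩
        left_inv := fun f => rfl
        right_inv := fun f => rfl }
  have hfin : Finite (F →g G) := Finite.of_injective (fun f : F →g G => (f : Fin s → V))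
    DFunLike.coe_injective
  have hsplit : Nat.card (F →g G) = G.labelledCopyCount F +
      Nat.card {f : F →g G // ¬ Function.Injective f} := by
    rw [hcopy, ← Nat.card_sum]
    exact Nat.card_congr (Equiv.sumCompl _).symm
  have hbad : (Nat.card {f : F →g G // ¬ Function.Injective f} : ℝ) ≤
      ∑ q : Fin s × Fin s, if q.1 ≠ q.2 then
        ((Finset.univ.filter fun x : Fin s → V => x q.1 = x q.2).card : ℝ) else 0 := by
    set B : Finset (Fin s → V) :=
      (Finset.univ.filter fun q : Fin s × Fin s => q.1 ≠ q.2).biUnion fun q =>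
        Finset.univ.filter fun x : Fin s → V => x q.1 = x q.2 with hB
    have h1 : Nat.card {f : F →g G // ¬ Function.Injective f} ≤ B.card := by
      rw [← Fintype.card_coe, ← Nat.card_eq_fintype_card]
      have hmem : ∀ f : {f : F →g G // ¬ Function.Injective f}, (f.1 : Fin s → V) ∈ B := by
        intro f
        obtain ⟨a, b, hab, hne⟩ := Function.not_injective_iff.1 f.2
        simp only [hB, Finset.mem_biUnion, Finset.mem_filter, Finset.mem_univ, true_and]
        exact ⟨(a, b), hne, hab⟩
      refine Nat.card_le_card_of_injective
        (fun f : {f : F →g G // ¬ Function.Injective f} => (⟨f.1, hmem f⟩ : B)) fun f g h => ?_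
      exact Subtype.ext (DFunLike.coe_injective (congrArg Subtype.val h))
    rw [← Finset.sum_filter]
    exact_mod_cast h1.trans Finset.card_biUnion_le
  have hle : (Fintype.card V : ℝ) * Nat.card {f : F →g G // ¬ Function.Injective f} ≤
      (s : ℝ) ^ 2 * (Fintype.card V : ℝ) ^ s := by
    refine (mul_le_mul_of_nonneg_left hbad hN0.le).trans ?_
    rw [Finset.mul_sum]
    calc _ ≤ ∑ q : Fin s × Fin s, (Fintype.card V : ℝ) ^ s := by
          refine Finset.sum_le_sum fun q _ => ?_
          split_ifs with hq
          · rw [card_filter_eq_mul_card hq]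
          · rw [mul_zero]
            positivity
      _ = _ := by simp [sq]
  have h2 : homDensity F G - copyDensity F G =
      Nat.card {f : F →g G // ¬ Function.Injective f} / (Fintype.card V : ℝ) ^ s := by
    rw [homDensity, copyDensity, hsplit]
    push_cast
    ring
  rw [h2, abs_of_nonneg (by positivity), div_le_div_iff₀ (by positivity) hN0]
  linarith

end HomCount

section Sequence

variable {V : ℕ → Type*} [∀ n, Fintype (V n)]

lemma isQuasiRandom_iff_tendsto_homDensity (G : ∀ n, SimpleGraph (V n))
    (hV : Tendsto (fun n => Fintype.card (V n)) atTop atTop) (p : ℝ) :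
    IsQuasiRandom G p ↔ ∀ (s : ℕ) (F : SimpleGraph (Fin s)),
      Tendsto (fun n => homDensity F (G n)) atTop (𝓝 (p ^ F.edgeSet.ncard)) := by
  refine forall_congr' fun s => forall_congr' fun F => ?_
  have h : Tendsto (fun n => homDensity F (G n) - copyDensity F (G n)) atTop (𝓝 0) := by
    have h1 : Tendsto (fun n => (s : ℝ) ^ 2 / (Fintype.card (V n) : ℝ)) atTop (𝓝 0) :=
      (tendsto_natCast_atTop_atTop.comp hV).const_div_atTop _
    refine squeeze_zero_norm' ?_ h1
    filter_upwards [eventually_nonempty hV] with n hn using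
      abs_homDensity_sub_copyDensity_le (G n) F
  constructor
  · intro hc
    simpa using h.add hc
  · intro hc
    simpa using hc.sub h

/-- The edge density and the density of four-cycles force quasi-randomness. -/
theorem isQuasiRandom_iff_tendsto_densities (G : ∀ n, SimpleGraph (V n))
    (hV : Tendsto (fun n => Fintype.card (V n)) atTop atTop) {p : ℝ}
    (hp : p ∈ Set.Icc (0 : ℝ) 1) :
    IsQuasiRandom G p ↔ Tendsto (fun n => edgeDensity (G n)) atTop (𝓝 p) ∧
      Tendsto (fun n => fourCycleDensity (G n)) atTop (𝓝 (p ^ 4)) := by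
  classical
  rw [isQuasiRandom_iff_tendsto_homDensity G hV p]
  constructor
  · intro h
    constructor
    · have h2 := h 2 ⊤
      simp only [homDensity_top_two] at h2
      rwa [← card_edgePairs, edgePairs_top_two, Finset.card_singleton, pow_one] at h2
    · have h4 := h 4 (SimpleGraph.cycleGraph 4)
      simp only [homDensity_cycleGraph_four] at h4
      rwa [← card_edgePairs, edgePairs_cycleGraph_four] at h4
  · rintro ⟨he, hc⟩ s F
    rw [tendsto_iff_norm_sub_tendsto_zero]
    have h1 : Tendsto (fun n => (F.edgeSet.ncard : ℝ) * Real.sqrt (Real.sqrt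
        (3 * (fourCycleDensity (G n) + 3 * p ^ 4 - 4 * p ^ 3 * edgeDensity (G n))))) atTop
        (𝓝 (F.edgeSet.ncard * Real.sqrt (Real.sqrt
          (3 * (p ^ 4 + 3 * p ^ 4 - 4 * p ^ 3 * p))))) :=
      (((hc.add_const _).sub (he.const_mul _)).const_mul 3).sqrt.sqrt.const_mul _
    rw [show 3 * (p ^ 4 + 3 * p ^ 4 - 4 * p ^ 3 * p) = 0 by ring, Real.sqrt_zero, Real.sqrt_zero,
      mul_zero] at h1
    refine squeeze_zero' (Eventually.of_forall fun n => norm_nonneg _) ?_ h1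
    filter_upwards [eventually_nonempty hV] with n hn using abs_homDensity_sub_le (G n) hp F

end Sequence

/-! ### Hilbert–Schmidt operators -/

section HilbertSchmidt

universe u

variable {H : Type u} [NormedAddCommGroup H] [InnerProductSpace ℝ H]

lemma norm_sum_inner_smul_le {ι : Type*} (b : HilbertBasis ι ℝ H) (T : H →L[ℝ] H) (x : H)
    (s : Finset ι) :
    ‖∑ i ∈ s, inner ℝ (b i) x • T (b i)‖ ≤ Real.sqrt (∑ i ∈ s, ‖T (b i)‖ ^ 2) * ‖x‖ := by
  have h1 : ‖∑ i ∈ s, inner ℝ (b i) x • T (b i)‖ ≤ ∑ i ∈ s, |inner ℝ (b i) x| * ‖T (b i)‖ :=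
    (norm_sum_le _ _).trans (le_of_eq (Finset.sum_congr rfl fun i _ => by
      rw [norm_smul, Real.norm_eq_abs]))
  refine h1.trans ?_
  have h2 := Finset.sum_mul_sq_le_sq_mul_sq s (fun i => |inner ℝ (b i) x|) (fun i => ‖T (b i)‖)
  have h3 : ∑ i ∈ s, |inner ℝ (b i) x| ^ 2 ≤ ‖x‖ ^ 2 := b.orthonormal.sum_inner_products_le x
  have h4 : 0 ≤ ∑ i ∈ s, ‖T (b i)‖ ^ 2 := Finset.sum_nonneg fun i _ => sq_nonneg _
  refine (sq_le_sq₀ (Finset.sum_nonneg fun i _ => by positivity) (by positivity)).1 ?_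
  rw [mul_pow, Real.sq_sqrt h4, mul_comm]
  exact h2.trans (mul_le_mul_of_nonneg_right h3 h4)

/-- An operator with a finite Hilbert–Schmidt norm is a limit of operators of finite rank. -/
lemma isCompactOperator_of_summable_norm_sq [CompleteSpace H] {ι : Type*} (b : HilbertBasis ι ℝ H)
    (T : H →L[ℝ] H) (h : Summable fun i => ‖T (b i)‖ ^ 2) : IsCompactOperator T := by
  classical
  set F : Finset ι → H →L[ℝ] H := fun s => ∑ i ∈ s, (innerSL ℝ (b i)).smulRight (T (b i)) with hF
  have hcomp : ∀ s, IsCompactOperator (F s) := by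
    intro s
    refine Submodule.sum_mem (compactOperator (RingHom.id ℝ) H H) fun i _ => ?_
    exact (isCompactOperator_of_locallyCompactSpace_rng
      (ContinuousLinearMap.toSpanSingleton ℝ (T (b i)))).comp_clm (innerSL ℝ (b i))
  have hlim : Tendsto F atTop (𝓝 T) := by
    rw [Metric.tendsto_nhds]
    intro ε hε
    obtain ⟨s, hs⟩ := summable_iff_vanishing_norm.1 h ((ε / 2) ^ 2) (by positivity)
    filter_upwards [eventually_ge_atTop s] with t ht
    rw [dist_eq_norm]
    refine lt_of_le_of_lt (ContinuousLinearMap.opNorm_le_bound _ (by positivity : 0 ≤ ε / 2)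
      fun x => ?_) (half_lt_self hε)
    have hx : HasSum (fun i => inner ℝ (b i) x • T (b i)) (T x) := by
      have := (b.hasSum_repr x).mapL T
      simpa [b.repr_apply_apply] using this
    have hFx : ∀ r, F r x = ∑ i ∈ r, inner ℝ (b i) x • T (b i) := fun r => by
      simp [hF]
    have hle : ∀ r ≥ t, ‖F t x - ∑ i ∈ r, inner ℝ (b i) x • T (b i)‖ ≤ ε / 2 * ‖x‖ := by
      intro r hr
      rw [hFx, norm_sub_rev, ← Finset.sum_sdiff_eq_sub hr]
      refine (norm_sum_inner_smul_le b T x _).trans ?_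
      gcongr
      apply Real.sqrt_le_iff.2 ⟨by positivity, ?_⟩
      have := hs (r \ t) (Finset.disjoint_of_subset_right ht Finset.sdiff_disjoint)
      exact ((le_abs_self _).trans_lt this).le
    rw [sub_apply]
    exact le_of_tendsto ((tendsto_const_nhds.sub hx).norm)
      ((eventually_ge_atTop t).mono fun r hr => hle r hr)
  exact isCompactOperator_of_tendsto hlim (Eventually.of_forall hcomp)

/-- A compact self-adjoint operator has a Hilbert basis of eigenvectors, indexed by pairs of a real
number and an element of an index set with as many elements as its multiplicity. -/
lemma exists_hilbertBasis_eigenvectors [CompleteSpace H] (T : H →L[ℝ] H)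
    (hT : IsCompactOperator T) (hsymm : (T : H →ₗ[ℝ] H).IsSymmetric) :
    ∃ (κ : ℝ → Type u) (B : HilbertBasis (Σ l, κ l) ℝ H), (∀ i, T (B i) = i.1 • B i) ∧
      ∀ l ≠ 0, Finite (κ l) ∧
        Nat.card (κ l) = Module.finrank ℝ (Module.End.eigenspace (T : H →ₗ[ℝ] H) l) := by
  have hclosed : ∀ l : ℝ,
      IsClosed (Module.End.eigenspace (T : H →ₗ[ℝ] H) l : Set H) := by
    intro l
    have : (Module.End.eigenspace (T : H →ₗ[ℝ] H) l : Set H) = {v | T v = l • v} := by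
      ext v
      simp
    rw [this]
    exact isClosed_eq T.continuous (continuous_const_smul l)
  have hcomplete : ∀ l : ℝ, CompleteSpace (Module.End.eigenspace (T : H →ₗ[ℝ] H) l) :=
    fun l => (hclosed l).completeSpace_coe
  choose w b hb using fun l : ℝ =>
    exists_hilbertBasis ℝ (Module.End.eigenspace (T : H →ₗ[ℝ] H) l)
  have horth : Orthonormal ℝ fun i : Σ l, w l => ((b i.1 i.2 : _) : H) :=
    hsymm.orthogonalFamily_eigenspaces.orthonormal_sigma_orthonormal fun l => (b l).orthonormal
  have hbot : (Submodule.span ℝ (Set.range fun i : Σ l, w l => ((b i.1 i.2 : _) : H)))ᗮ = ⊥ := by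
    rw [eq_bot_iff, ← ContinuousLinearMap.orthogonalComplement_iSup_eigenspaces_eq_bot hT hsymm]
    intro v hv
    rw [← Submodule.iInf_orthogonal, Submodule.mem_iInf]
    intro l
    rw [Submodule.mem_orthogonal']
    intro x hx
    have hsum := ((b l).hasSum_repr ⟨x, hx⟩).mapL
      ((innerSL ℝ v).comp (Submodule.subtypeL _))
    have h0 : ∀ j, ((innerSL ℝ v).comp (Submodule.subtypeL _))
        ((b l).repr ⟨x, hx⟩ j • b l j) = 0 := by
      intro j
      rw [map_smul]
      have : inner ℝ v ((b l j : _) : H) = 0 :=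
        (Submodule.mem_orthogonal' _ _).1 hv _ (Submodule.subset_span ⟨⟨l, j⟩, rfl⟩)
      simp [this]
    simp only [h0] at hsum
    exact hsum.unique hasSum_zero
  refine ⟨fun l => w l, HilbertBasis.mkOfOrthogonalEqBot horth hbot, fun i => ?_, fun l hl => ?_⟩
  · rw [HilbertBasis.coe_mkOfOrthogonalEqBot]
    exact Module.End.mem_eigenspace_iff.1 (b i.1 i.2).2
  · have hfd := ContinuousLinearMap.finite_dimensional_eigenspace hT l hl
    have hfin : Finite (w l) := (b l).orthonormal.linearIndependent.finite
    have := Fintype.ofFinite (w l)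
    refine ⟨hfin, ?_⟩
    rw [Module.finrank_eq_card_basis (b l).toOrthonormalBasis.toBasis, Nat.card_eq_fintype_card]

lemma HilbertBasis.countable [TopologicalSpace.SeparableSpace H] {ι : Type*}
    (b : HilbertBasis ι ℝ H) : Countable ι := by
  have hdist : ∀ i j, i ≠ j → 1 ≤ dist (b i) (b j) := by
    intro i j hij
    have h := b.orthonormal
    have h1 : ‖b i - b j‖ ^ 2 = 2 := by
      rw [@norm_sub_sq ℝ, h.1 i, h.1 j, h.2 hij]
      norm_num
    rw [dist_eq_norm]
    nlinarith [norm_nonneg (b i - b j)]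
  refine Pairwise.countable_of_isOpen_disjoint (s := fun i => Metric.ball (b i) (1 / 2))
    (fun i j hij => ?_) (fun i => Metric.isOpen_ball) fun i => Metric.nonempty_ball.2 (by norm_num)
  exact Metric.ball_disjoint_ball (by linarith [hdist i j hij])

end HilbertSchmidt

/-! ### The kernel operator of a graphon -/

namespace Graphon

variable (W : Graphon)

/-- The integral of the kernel, that is `‖W‖₁`. -/
noncomputable def edgeIntegral : ℝ := ∫ q : I × I, W.kernel q.1 q.2

/-- The integral of the square of the kernel, that is `‖W‖₂²`. -/
noncomputable def sqIntegral : ℝ := ∫ q : I × I, W.kernel q.1 q.2 ^ 2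

lemma measurable_kernel_left (x : I) : Measurable (W.kernel x) :=
  W.measurable_kernel.comp measurable_prodMk_left

lemma norm_kernel_le (x y : I) : ‖W.kernel x y‖ ≤ 1 := by
  have h := W.kernel_mem x y
  rw [Real.norm_eq_abs, abs_of_nonneg h.1]
  exact h.2

lemma memLp_kernel (x : I) : MemLp (W.kernel x) 2 (volume : Measure I) :=
  MemLp.of_bound (W.measurable_kernel_left x).aestronglyMeasurable 1
    (ae_of_all _ fun y => W.norm_kernel_le x y)

lemma integrable_kernel_sq : Integrable (fun q : I × I => W.kernel q.1 q.2 ^ 2) := by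
  refine Integrable.of_bound (C := 1)
    (W.measurable_kernel.pow_const 2).aestronglyMeasurable (ae_of_all _ fun q => ?_)
  rw [norm_pow]
  exact pow_le_one₀ (norm_nonneg _) (W.norm_kernel_le _ _)

lemma integrable_kernel : Integrable (fun q : I × I => W.kernel q.1 q.2) :=
  Integrable.of_bound (C := 1) W.measurable_kernel.aestronglyMeasurable
    (ae_of_all _ fun _ => W.norm_kernel_le _ _)

lemma sqIntegral_le_one : W.sqIntegral ≤ 1 := by
  calc W.sqIntegral ≤ ∫ _q : I × I, (1 : ℝ) := by
        refine integral_mono W.integrable_kernel_sq (integrable_const _) fun q => ?_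
        have h := W.kernel_mem q.1 q.2
        exact pow_le_one₀ h.1 h.2
    _ = 1 := by simp

/-- The section `W(x, ·)` as an element of `L²`. -/
noncomputable def rowLp (x : I) : Lp ℝ 2 (volume : Measure I) := (W.memLp_kernel x).toLp _

lemma inner_rowLp (x : I) (f : Lp ℝ 2 (volume : Measure I)) :
    inner ℝ (W.rowLp x) f = ∫ y, W.kernel x y * f y := by
  rw [L2.inner_def]
  refine integral_congr_ae ?_
  filter_upwards [(W.memLp_kernel x).coeFn_toLp] with y hy
  rw [rowLp, hy]
  simp [mul_comm]

lemma norm_rowLp_sq (x : I) : ‖W.rowLp x‖ ^ 2 = ∫ y, W.kernel x y ^ 2 := by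
  rw [← real_inner_self_eq_norm_sq, inner_rowLp]
  refine integral_congr_ae ?_
  filter_upwards [(W.memLp_kernel x).coeFn_toLp] with y hy
  rw [rowLp, hy, sq]

lemma norm_rowLp_le (x : I) : ‖W.rowLp x‖ ≤ 1 := by
  have h : ‖W.rowLp x‖ ^ 2 ≤ 1 := by
    rw [norm_rowLp_sq]
    calc ∫ y, W.kernel x y ^ 2 ≤ ∫ _y : I, (1 : ℝ) := by
          refine integral_mono_of_nonneg (ae_of_all _ fun y => sq_nonneg _) (integrable_const _)
            (ae_of_all _ fun y => ?_)
          have h := W.kernel_mem x y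
          exact pow_le_one₀ h.1 h.2
      _ = 1 := by simp
  nlinarith [norm_nonneg (W.rowLp x)]

lemma coeFn_kernelOp (f : Lp ℝ 2 (volume : Measure I)) :
    (W.kernelOp f : I → ℝ) =ᵐ[volume] fun x => ∫ y, W.kernel x y * f y :=
  (W.memLp_kernelIntegral f).coeFn_toLp

lemma inner_kernelOp (f g : Lp ℝ 2 (volume : Measure I)) :
    inner ℝ (W.kernelOp f) g = ∫ x, (∫ y, W.kernel x y * f y) * g x := by
  rw [L2.inner_def]
  refine integral_congr_ae ?_
  filter_upwards [W.coeFn_kernelOp f] with x hx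
  rw [hx]
  simp [mul_comm]

lemma norm_kernelOp_sq (f : Lp ℝ 2 (volume : Measure I)) :
    ‖W.kernelOp f‖ ^ 2 = ∫ x, inner ℝ (W.rowLp x) f ^ 2 := by
  rw [← real_inner_self_eq_norm_sq, inner_kernelOp]
  refine integral_congr_ae ?_
  filter_upwards [W.coeFn_kernelOp f] with x hx
  rw [hx, inner_rowLp, sq]

lemma integrable_coeFn (f : Lp ℝ 2 (volume : Measure I)) : Integrable (f : I → ℝ) :=
  (Lp.memLp f).integrable (by norm_num)

lemma isSymmetric_kernelOp : W.kernelOp.IsSymmetric := by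
  intro f g
  rw [inner_kernelOp, real_inner_comm, inner_kernelOp]
  have hint : Integrable (Function.uncurry fun x y => W.kernel x y * (g x * f y))
      ((volume : Measure I).prod volume) := by
    refine ((integrable_coeFn g).mul_prod (integrable_coeFn f)).bdd_mul (c := 1)
      W.measurable_kernel.aestronglyMeasurable (ae_of_all _ fun q => W.norm_kernel_le _ _)
  calc ∫ x, (∫ y, W.kernel x y * f y) * g x = ∫ x, ∫ y, W.kernel x y * (g x * f y) := by
        congr 1 with x
        rw [← integral_mul_const]
        congr 1 with y
        ring
    _ = ∫ y, ∫ x, W.kernel x y * (g x * f y) := integral_integral_swap hint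
    _ = _ := by
        congr 1 with y
        rw [← integral_mul_const]
        congr 1 with x
        rw [W.kernel_symm x y]
        ring

lemma norm_kernelOp_le (f : Lp ℝ 2 (volume : Measure I)) : ‖W.kernelOp f‖ ≤ 1 * ‖f‖ := by
  have h : ‖W.kernelOp f‖ ^ 2 ≤ ‖f‖ ^ 2 := by
    rw [norm_kernelOp_sq]
    calc ∫ x, inner ℝ (W.rowLp x) f ^ 2 ≤ ∫ _x : I, ‖f‖ ^ 2 := by
          refine integral_mono_of_nonneg (ae_of_all _ fun x => sq_nonneg _) (integrable_const _)
            (ae_of_all _ fun x => ?_)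
          have h1 := abs_real_inner_le_norm (W.rowLp x) f
          have h2 := mul_le_mul_of_nonneg_right (W.norm_rowLp_le x) (norm_nonneg f)
          simp only
          rw [← sq_abs]
          exact pow_le_pow_left₀ (abs_nonneg _) (h1.trans (by linarith)) 2
      _ = ‖f‖ ^ 2 := by simp
  rw [one_mul]
  exact (sq_le_sq₀ (norm_nonneg _) (norm_nonneg _)).1 h

/-- The kernel operator as a continuous linear map, of norm at most `1`. -/
noncomputable def kernelCLM : Lp ℝ 2 (volume : Measure I) →L[ℝ] Lp ℝ 2 (volume : Measure I) :=
  W.kernelOp.mkContinuous 1 W.norm_kernelOp_le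

/-- The Hilbert–Schmidt norm of the kernel operator, in any Hilbert basis. -/
lemma hasSum_norm_kernelOp_sq {ι : Type*} (b : HilbertBasis ι ℝ (Lp ℝ 2 (volume : Measure I))) :
    HasSum (fun i => ‖W.kernelOp (b i)‖ ^ 2) W.sqIntegral := by
  have : Fact ((2 : ENNReal) ≠ ⊤) := ⟨by norm_num⟩
  have hcount : Countable ι := b.countable
  have hmeas : ∀ i, AEStronglyMeasurable (fun x => inner ℝ (W.rowLp x) (b i) ^ 2)
      (volume : Measure I) := by
    intro i
    simp_rw [inner_rowLp]
    exact ((W.memLp_kernelIntegral (b i)).aestronglyMeasurable).pow 2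
  have hparseval : ∀ x, HasSum (fun i => inner ℝ (W.rowLp x) (b i) ^ 2) (‖W.rowLp x‖ ^ 2) := by
    intro x
    have h := b.hasSum_inner_mul_inner (W.rowLp x) (W.rowLp x)
    rw [real_inner_self_eq_norm_sq] at h
    refine (congrArg (fun f => HasSum f _) (funext fun i => ?_)).mpr h
    rw [real_inner_comm (W.rowLp x) (b i), sq]
  have hle : ∀ i x, inner ℝ (W.rowLp x) (b i) ^ 2 ≤ 1 := fun i x =>
    (le_hasSum (hparseval x) i fun j _ => sq_nonneg _).trans
      (pow_le_one₀ (norm_nonneg _) (W.norm_rowLp_le x))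
  have hint : ∀ i, Integrable (fun x => inner ℝ (W.rowLp x) (b i) ^ 2) (volume : Measure I) := by
    intro i
    refine Integrable.of_bound (C := 1) (hmeas i) (ae_of_all _ fun x => ?_)
    rw [Real.norm_eq_abs, abs_of_nonneg (sq_nonneg _)]
    exact hle i x
  have hsummable : Summable fun i => ∫ x, ‖inner ℝ (W.rowLp x) (b i) ^ 2‖ := by
    refine summable_of_sum_le (c := 1) (fun i => integral_nonneg fun x => norm_nonneg _) fun s => ?_
    rw [← integral_finsetSum _ fun i _ => (hint i).norm]
    calc _ ≤ ∫ _x : I, (1 : ℝ) := by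
          refine integral_mono_of_nonneg
            (ae_of_all _ fun x => Finset.sum_nonneg fun i _ => norm_nonneg _) (integrable_const _)
            (ae_of_all _ fun x => ?_)
          simp only [norm_pow, Real.norm_eq_abs, sq_abs]
          exact (sum_le_hasSum s (fun i _ => sq_nonneg _) (hparseval x)).trans
            (pow_le_one₀ (norm_nonneg _) (W.norm_rowLp_le x))
      _ = 1 := by simp
  have h := hasSum_integral_of_summable_integral_norm hint hsummable
  simp_rw [norm_kernelOp_sq]
  have hval : ∫ x, ∑' i, inner ℝ (W.rowLp x) (b i) ^ 2 = W.sqIntegral := by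
    rw [sqIntegral, Measure.volume_eq_prod, integral_prod _ W.integrable_kernel_sq]
    congr 1 with x
    rw [(hparseval x).tsum_eq, norm_rowLp_sq]
  rwa [hval] at h

lemma isCompactOperator_kernelCLM : IsCompactOperator W.kernelCLM := by
  obtain ⟨w, b, -⟩ := exists_hilbertBasis ℝ (Lp ℝ 2 (volume : Measure I))
  exact isCompactOperator_of_summable_norm_sq b _ (W.hasSum_norm_kernelOp_sq b).summable

/-- The kernel `∫ z, W(x, z) W(z, y)` of the square of the kernel operator. -/
noncomputable def comp : Graphon where
  kernel x y := ∫ z, W.kernel x z * W.kernel z y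
  measurable_kernel := by
    refine StronglyMeasurable.measurable ?_
    refine StronglyMeasurable.integral_prod_right
      (f := fun (q : I × I) (z : I) => W.kernel q.1 z * W.kernel z q.2) ?_
    refine Measurable.stronglyMeasurable ?_
    exact (W.measurable_kernel.comp ((measurable_fst.comp measurable_fst).prodMk measurable_snd)).mul
      (W.measurable_kernel.comp (measurable_snd.prodMk (measurable_snd.comp measurable_fst)))
  kernel_symm x y := by
    congr 1 with z
    rw [W.kernel_symm x z, W.kernel_symm z y, mul_comm]
  kernel_mem x y := by
    refine ⟨integral_nonneg fun z => mul_nonneg (W.kernel_mem x z).1 (W.kernel_mem z y).1, ?_⟩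
    calc ∫ z, W.kernel x z * W.kernel z y ≤ ∫ _z : I, (1 : ℝ) := by
          refine integral_mono_of_nonneg
            (ae_of_all _ fun z => mul_nonneg (W.kernel_mem x z).1 (W.kernel_mem z y).1)
            (integrable_const _) (ae_of_all _ fun z => ?_)
          exact mul_le_one₀ (W.kernel_mem x z).2 (W.kernel_mem z y).1 (W.kernel_mem z y).2
      _ = 1 := by simp

lemma kernelOp_comp (f : Lp ℝ 2 (volume : Measure I)) :
    W.comp.kernelOp f = W.kernelOp (W.kernelOp f) := by
  apply Lp.ext
  filter_upwards [W.comp.coeFn_kernelOp f, W.coeFn_kernelOp (W.kernelOp f)] with x h1 h2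
  rw [h1, h2]
  have hint : Integrable (Function.uncurry fun y z => (W.kernel x z * W.kernel z y) * (f y * 1))
      ((volume : Measure I).prod volume) := by
    refine ((integrable_coeFn f).mul_prod (integrable_const (1 : ℝ))).bdd_mul (c := 1) ?_
      (ae_of_all _ fun q => ?_)
    · exact (((W.measurable_kernel_left x).comp measurable_snd).mul
        (W.measurable_kernel.comp (measurable_snd.prodMk measurable_fst))).aestronglyMeasurable
    · rw [norm_mul]
      exact mul_le_one₀ (W.norm_kernel_le _ _) (norm_nonneg _) (W.norm_kernel_le _ _)
  calc ∫ y, (∫ z, W.kernel x z * W.kernel z y) * f y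
      = ∫ y, ∫ z, (W.kernel x z * W.kernel z y) * (f y * 1) := by
        congr 1 with y
        rw [← integral_mul_const]
        simp
    _ = ∫ z, ∫ y, (W.kernel x z * W.kernel z y) * (f y * 1) := integral_integral_swap hint
    _ = ∫ z, W.kernel x z * ∫ y, W.kernel z y * f y := by
        congr 1 with z
        rw [← integral_const_mul]
        congr 1 with y
        ring
    _ = ∫ z, W.kernel x z * W.kernelOp f z := by
        refine integral_congr_ae ?_
        filter_upwards [W.coeFn_kernelOp f] with z hz
        rw [hz]

/-- The eigenvalues of a graphon, as a family: their power sums are the densities of cycles, the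
regularized determinant is the product over the family, and the integral of the kernel is an average
of them. -/
lemma exists_eigenvalues : ∃ (ι : Type) (μ c : ι → ℝ), HasSum (fun i => μ i ^ 2) W.sqIntegral ∧
    HasSum (fun i => μ i ^ 4) W.comp.sqIntegral ∧
    (∀ z : ℂ, HasProd (fun i => (1 - (μ i : ℂ) * z) * Complex.exp ((μ i : ℂ) * z)) (W.det2 z)) ∧
    HasSum (fun i => c i ^ 2) 1 ∧ HasSum (fun i => μ i * c i ^ 2) W.edgeIntegral := by
  obtain ⟨κ, B, hB, hκ⟩ := exists_hilbertBasis_eigenvectors W.kernelCLM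
    W.isCompactOperator_kernelCLM W.isSymmetric_kernelOp
  have hB' : ∀ i, W.kernelOp (B i) = i.1 • B i := hB
  have hsq : HasSum (fun i : Σ l, κ l => i.1 ^ 2) W.sqIntegral := by
    convert W.hasSum_norm_kernelOp_sq B using 2 with i
    rw [hB', norm_smul, B.orthonormal.1 i, mul_one, Real.norm_eq_abs, sq_abs]
  -- the weights `c i ^ 2` come from the constant function `1`, a unit vector
  set e : Lp ℝ 2 (volume : Measure I) := (memLp_const (1 : ℝ)).toLp _ with he
  have hecoe : (e : I → ℝ) =ᵐ[volume] fun _ => (1 : ℝ) := (memLp_const (1 : ℝ)).coeFn_toLp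
  refine ⟨Σ l, κ l, fun i => i.1, fun i => inner ℝ (B i) e, hsq, ?_, ?_, ?_, ?_⟩
  · convert W.comp.hasSum_norm_kernelOp_sq B using 2 with i
    rw [kernelOp_comp, hB', map_smul, hB', smul_smul, norm_smul, B.orthonormal.1 i, mul_one,
      Real.norm_eq_abs, sq_abs]
    ring
  · intro z
    -- the fiber over `l ≠ 0` has `eigMult l` elements; the one over `0` contributes factors `1`
    obtain ⟨E, hE⟩ := multipliable_one_sub_mul_exp hsq.summable z
    have hfib : HasProd (fun l : ℝ =>
        ((1 - (l : ℂ) * z) * Complex.exp ((l : ℂ) * z)) ^ W.eigMult l) E := by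
      refine hE.sigma fun l => ?_
      by_cases hl : l = 0
      · subst hl
        simp
      · obtain ⟨hfin, hcard⟩ := hκ l hl
        have := Fintype.ofFinite (κ l)
        have h := hasProd_fintype fun _ : κ l => (1 - (l : ℂ) * z) * Complex.exp ((l : ℂ) * z)
        rw [Finset.prod_const, Finset.card_univ, ← Nat.card_eq_fintype_card, hcard] at h
        exact h
    rw [det2, hfib.tprod_eq]
    exact hE
  · have h := B.hasSum_inner_mul_inner e e
    have h1 : inner ℝ e e = (1 : ℝ) := by
      rw [L2.inner_def]
      calc _ = ∫ _x : I, (1 : ℝ) := by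
            refine integral_congr_ae ?_
            filter_upwards [hecoe] with x hx
            rw [hx]
            simp
        _ = 1 := by simp
    rw [h1] at h
    refine (congrArg (fun f => HasSum f _) (funext fun i => ?_)).mpr h
    rw [real_inner_comm (B i) e, sq]
  · have h := B.hasSum_inner_mul_inner (W.kernelOp e) e
    have h1 : inner ℝ (W.kernelOp e) e = W.edgeIntegral := by
      rw [inner_kernelOp, edgeIntegral, Measure.volume_eq_prod, integral_prod _ W.integrable_kernel]
      refine integral_congr_ae ?_
      filter_upwards [hecoe] with x hx
      rw [hx, mul_one]
      refine integral_congr_ae ?_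
      filter_upwards [hecoe] with y hy
      rw [hy, mul_one]
    rw [h1] at h
    refine (congrArg (fun f => HasSum f _) (funext fun i => ?_)).mpr h
    rw [W.isSymmetric_kernelOp e (B i), hB', inner_smul_right, real_inner_comm (B i) e]
    ring

/-! ### Graphons with the densities of a constant -/

lemma charPowerSeries_eq (z : ℂ) : W.charPowerSeries z =
    W.det2 z * Complex.exp (z ^ 2 * ((W.sqIntegral - W.edgeIntegral : ℝ) : ℂ) / 2) := by
  have h : ∀ q : I × I, |W.kernel q.1 q.2| = W.kernel q.1 q.2 := fun q =>
    abs_of_nonneg (W.kernel_mem _ _).1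
  simp only [charPowerSeries, h, sqIntegral, edgeIntegral, mul_div_assoc]

/-- The average of the eigenvalues in `exists_eigenvalues` is `p` only if one of them is `p`, since
none exceeds `p`; then all others vanish. -/
theorem charPowerSeries_eq_quasiPsi {p : ℝ} (hp : 0 ≤ p) (he : W.edgeIntegral = p)
    (hc : W.comp.sqIntegral = p ^ 4) (z : ℂ) : W.charPowerSeries z = quasiPsi p z := by
  classical
  obtain ⟨ι, μ, c, h2, h4, hdet, hc1, hμc⟩ := W.exists_eigenvalues
  rw [hc] at h4
  rw [he] at hμc
  have hpos : ∀ x : ℝ, 0 ≤ x ^ 4 := fun x => by positivity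
  have hle : ∀ i, μ i ≤ p := fun i => by
    have h := le_hasSum h4 i fun j _ => hpos _
    exact le_of_not_gt fun hlt => absurd h (not_le.2 (pow_lt_pow_left₀ hlt hp (by norm_num)))
  have hex : ∃ i, μ i = p := by
    by_contra hne
    push Not at hne
    have h0 : HasSum (fun i => (p - μ i) * c i ^ 2) 0 := by
      have := (hc1.mul_left p).sub hμc
      simpa [sub_mul] using this
    have h1 := (hasSum_zero_iff_of_nonneg fun i =>
      mul_nonneg (sub_nonneg.2 (hle i)) (sq_nonneg (c i))).1 h0
    have hc0 : ∀ i, c i ^ 2 = 0 := fun i =>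
      (mul_eq_zero.1 (congrFun h1 i)).resolve_left (sub_ne_zero.2 (hne i).symm)
    simp only [hc0] at hc1
    exact zero_ne_one (hasSum_zero.unique hc1)
  obtain ⟨i₀, hi₀⟩ := hex
  have hzero : ∀ i ≠ i₀, μ i = 0 := by
    intro i hi
    have h := sum_le_hasSum {i, i₀} (fun j _ => hpos (μ j)) h4
    rw [Finset.sum_pair hi, hi₀] at h
    have h5 : μ i ^ 4 = 0 := le_antisymm (by linarith) (hpos _)
    exact pow_eq_zero_iff (by norm_num) |>.1 h5
  have hsq : W.sqIntegral = p ^ 2 := by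
    rw [← hi₀]
    exact h2.unique (hasSum_single i₀ fun i hi => by simp [hzero i hi])
  have hd : W.det2 z = (1 - p * z) * Complex.exp (p * z) := by
    rw [← hi₀]
    exact (hdet z).unique (hasProd_single i₀ fun i hi => by simp [hzero i hi])
  rw [charPowerSeries_eq, hd, hsq, he, quasiPsi, mul_assoc, ← Complex.exp_add]
  congr 2
  push_cast
  ring

theorem edgeIntegral_eq_and_comp_sqIntegral_eq {p : ℝ} (hp : p ∈ Set.Icc (0 : ℝ) 1)
    (h : ∀ z, W.charPowerSeries z = quasiPsi p z) :
    W.edgeIntegral = p ∧ W.comp.sqIntegral = p ^ 4 := by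
  obtain ⟨ι, μ, c, h2, h4, hdet, -, -⟩ := W.exists_eigenvalues
  have hlog : ∀ (u : ℝ) (z : ℂ), 0 < u → u ≤ 1 / 2 → z ^ 2 = -u → ∃ L : ℝ,
      W.charPowerSeries z * W.charPowerSeries (-z) = Complex.exp L ∧
        |L - (W.edgeIntegral * u - W.comp.sqIntegral * u ^ 2 / 2)| ≤ 2 * u ^ 3 := by
    intro u z hu0 hu1 hz
    obtain ⟨L, hL1, hL2⟩ := exists_log_mul_of_hasProd h2 W.sqIntegral_le_one h4 hu0.le hu1 hz
      (hdet z) (hdet (-z))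
    refine ⟨L - (W.sqIntegral - W.edgeIntegral) * u, ?_, ?_⟩
    · rw [charPowerSeries_eq, charPowerSeries_eq, neg_sq, hz, mul_mul_mul_comm, hL1,
        ← Complex.exp_add, ← Complex.exp_add]
      congr 1
      push_cast
      ring
    · convert hL2 using 2
      ring
  -- a constant sequence turns the statement about limits into one about `W`
  have hlim := tendsto_coeffs_of_tendsto_mul (e := fun _ => W.edgeIntegral)
    (c := fun _ => W.comp.sqIntegral) (ψ := fun _ => W.charPowerSeries) hp
    (Eventually.of_forall fun _ => ?_) (Eventually.of_forall fun _ => hlog)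
    fun z => by rw [h z]; exact tendsto_const_nhds
  · exact ⟨tendsto_nhds_unique tendsto_const_nhds hlim.1,
      tendsto_nhds_unique tendsto_const_nhds hlim.2⟩
  · have hnn : 0 ≤ W.comp.sqIntegral := integral_nonneg fun q => sq_nonneg _
    rw [abs_of_nonneg hnn]
    exact W.comp.sqIntegral_le_one

/-! ### Homomorphism densities of graphons -/

lemma integral_fun_succ {n : ℕ} (g : (Fin (n + 1) → I) → ℝ) (hg : Integrable g) :
    ∫ x, g x = ∫ a, ∫ x : Fin n → I, g (Fin.cons a x) := by
  have h := volume_preserving_piFinSuccAbove (fun _ : Fin (n + 1) => I) 0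
  rw [← h.symm.integral_comp' g, Measure.volume_eq_prod, integral_prod]
  · congr 1 with a
    congr 1 with x
    exact congrArg g (Fin.insertNth_zero' a x)
  · exact (h.symm.integrable_comp_emb (MeasurableEquiv.measurableEmbedding _)).2 hg

lemma homDensity_eq {s : ℕ} (F : SimpleGraph (Fin s)) : W.homDensity F =
    ∫ x : Fin s → I, ∏ e ∈ edgePairs F, W.kernel (x e.1) (x e.2) := rfl

lemma measurable_kernel_comp {α : Type*} [MeasurableSpace α] {f g : α → I} (hf : Measurable f)
    (hg : Measurable g) : Measurable fun a => W.kernel (f a) (g a) :=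
  W.measurable_kernel.comp (hf.prodMk hg)

lemma integrable_kernel_comp {α : Type*} [MeasurableSpace α] {ν : Measure α} [IsFiniteMeasure ν]
    {f g : α → I} (hf : Measurable f) (hg : Measurable g) :
    Integrable (fun a => W.kernel (f a) (g a)) ν :=
  Integrable.of_bound (C := 1) (W.measurable_kernel_comp hf hg).aestronglyMeasurable
    (ae_of_all _ fun _ => W.norm_kernel_le _ _)

lemma integrable_kernel_comp_mul {α : Type*} [MeasurableSpace α] {ν : Measure α}
    {f g : α → I} (hf : Measurable f) (hg : Measurable g) {h : α → ℝ} (hh : Integrable h ν) :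
    Integrable (fun a => W.kernel (f a) (g a) * h a) ν :=
  hh.bdd_mul (c := 1) (W.measurable_kernel_comp hf hg).aestronglyMeasurable
    (ae_of_all _ fun _ => W.norm_kernel_le _ _)

lemma homDensity_top_two : W.homDensity (⊤ : SimpleGraph (Fin 2)) = W.edgeIntegral := by
  rw [homDensity_eq, edgePairs_top_two]
  simp_rw [Finset.prod_singleton]
  rw [integral_fun_succ _ (W.integrable_kernel_comp (by fun_prop) (by fun_prop)), edgeIntegral,
    Measure.volume_eq_prod, integral_prod _ W.integrable_kernel]
  congr 1 with a
  rw [integral_fun_succ _ (W.integrable_kernel_comp (by fun_prop) (by fun_prop))]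
  congr 1 with b
  rw [integral_unique]
  simp

lemma homDensity_cycleGraph_four :
    W.homDensity (SimpleGraph.cycleGraph 4) = W.comp.sqIntegral := by
  have hprod : ∀ x : Fin 4 → I, ∏ e ∈ ({(0, 1), (1, 2), (2, 3), (0, 3)} : Finset (Fin 4 × Fin 4)),
      W.kernel (x e.1) (x e.2) = W.kernel (x 0) (x 1) * (W.kernel (x 1) (x 2) *
        (W.kernel (x 0) (x 3) * W.kernel (x 3) (x 2))) := by
    intro x
    rw [Finset.prod_insert (by decide), Finset.prod_insert (by decide),
      Finset.prod_insert (by decide), Finset.prod_singleton, W.kernel_symm (x 2) (x 3)]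
    ring
  rw [homDensity_eq, edgePairs_cycleGraph_four]
  simp_rw [hprod]
  have hint : ∀ {α : Type} [MeasurableSpace α] {ν : Measure α} [IsFiniteMeasure ν]
      {f₀ f₁ f₂ f₃ : α → I}, Measurable f₀ → Measurable f₁ → Measurable f₂ → Measurable f₃ →
      Integrable (fun a => W.kernel (f₀ a) (f₁ a) * (W.kernel (f₁ a) (f₂ a) *
        (W.kernel (f₀ a) (f₃ a) * W.kernel (f₃ a) (f₂ a)))) ν := fun h₀ h₁ h₂ h₃ =>
    W.integrable_kernel_comp_mul h₀ h₁ (W.integrable_kernel_comp_mul h₁ h₂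
      (W.integrable_kernel_comp_mul h₀ h₃ (W.integrable_kernel_comp h₃ h₂)))
  rw [integral_fun_succ _ (hint (by fun_prop) (by fun_prop) (by fun_prop) (by fun_prop)),
    sqIntegral, Measure.volume_eq_prod, integral_prod _ W.comp.integrable_kernel_sq]
  congr 1 with a
  have hiter : ∫ x : Fin 3 → I, W.kernel a (x 0) * (W.kernel (x 0) (x 1) *
      (W.kernel a (x 2) * W.kernel (x 2) (x 1))) = ∫ b, ∫ c, ∫ d, W.kernel a b *
        (W.kernel b c * (W.kernel a d * W.kernel d c)) := by
    rw [integral_fun_succ _ (hint (by fun_prop) (by fun_prop) (by fun_prop) (by fun_prop))]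
    congr 1 with b
    rw [integral_fun_succ _ (hint (by fun_prop) (by fun_prop) (by fun_prop) (by fun_prop))]
    congr 1 with c
    rw [integral_fun_succ _ (hint (by fun_prop) (by fun_prop) (by fun_prop) (by fun_prop))]
    congr 1 with d
    rw [integral_unique, probReal_univ, one_smul]
    rfl
  refine hiter.trans ?_
  have hbc : ∀ b c, ∫ d, W.kernel a b * (W.kernel b c * (W.kernel a d * W.kernel d c)) =
      W.kernel a b * (W.kernel b c * W.comp.kernel a c) := by
    intro b c
    rw [integral_const_mul, integral_const_mul]
    rfl
  simp_rw [hbc]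
  rw [integral_integral_swap]
  · congr 1 with c
    calc ∫ b, W.kernel a b * (W.kernel b c * W.comp.kernel a c)
        = (∫ b, W.kernel a b * W.kernel b c) * W.comp.kernel a c := by
          rw [← integral_mul_const]
          congr 1 with b
          ring
      _ = W.comp.kernel a c ^ 2 := by
          rw [sq]
          rfl
  · exact W.integrable_kernel_comp_mul measurable_const measurable_fst
      (W.integrable_kernel_comp_mul measurable_fst measurable_snd
        (W.comp.integrable_kernel_comp measurable_const measurable_snd))

end Graphon

/-! ### Quasi-random sequences and their limits -/

/-- The constant graphon `p`. -/
noncomputable def Graphon.const (p : ℝ) (hp : p ∈ Set.Icc (0 : ℝ) 1) : Graphon where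
  kernel _ _ := p
  measurable_kernel := measurable_const
  kernel_symm _ _ := rfl
  kernel_mem _ _ := hp

lemma Graphon.homDensity_const (p : ℝ) (hp : p ∈ Set.Icc (0 : ℝ) 1) {s : ℕ}
    (F : SimpleGraph (Fin s)) : (Graphon.const p hp).homDensity F = p ^ F.edgeSet.ncard := by
  rw [Graphon.homDensity_eq, ← card_edgePairs]
  simp [Graphon.const]

section Sequence

variable {V : ℕ → Type*} [∀ n, Fintype (V n)] (G : ∀ n, SimpleGraph (V n))

lemma LeftConverges.tendsto_densities {G : ∀ n, SimpleGraph (V n)} {W : Graphon}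
    (h : LeftConverges G W) : Tendsto (fun n => edgeDensity (G n)) atTop (𝓝 W.edgeIntegral) ∧
      Tendsto (fun n => fourCycleDensity (G n)) atTop (𝓝 W.comp.sqIntegral) := by
  have h2 := h 2 ⊤
  have h4 := h 4 (SimpleGraph.cycleGraph 4)
  simp only [homDensity_top_two, Graphon.homDensity_top_two] at h2
  simp only [homDensity_cycleGraph_four, Graphon.homDensity_cycleGraph_four] at h4
  exact ⟨h2, h4⟩

theorem isQuasiRandom_iff_tendsto_graphPsi
    (hV : Tendsto (fun n => Fintype.card (V n)) atTop atTop) {p : ℝ}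
    (hp : p ∈ Set.Icc (0 : ℝ) 1) :
    IsQuasiRandom G p ↔
      ∀ z, Tendsto (fun n => graphPsi (G n) z) atTop (𝓝 (quasiPsi p z)) := by
  rw [isQuasiRandom_iff_tendsto_densities G hV hp]
  exact ⟨fun h => tendsto_graphPsi_of_tendsto_densities G hV hp h.1 h.2,
    tendsto_densities_of_tendsto_graphPsi G hV hp⟩

theorem LeftConverges.isQuasiRandom_iff {G : ∀ n, SimpleGraph (V n)} {W : Graphon}
    (h : LeftConverges G W) (hV : Tendsto (fun n => Fintype.card (V n)) atTop atTop) {p : ℝ}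
    (hp : p ∈ Set.Icc (0 : ℝ) 1) :
    IsQuasiRandom G p ↔ ∀ z, W.charPowerSeries z = quasiPsi p z := by
  rw [isQuasiRandom_iff_tendsto_densities G hV hp]
  obtain ⟨he, hc⟩ := h.tendsto_densities
  constructor
  · rintro ⟨he', hc'⟩
    exact W.charPowerSeries_eq_quasiPsi hp.1 (tendsto_nhds_unique he he')
      (tendsto_nhds_unique hc hc')
  · intro hW
    obtain ⟨h1, h2⟩ := W.edgeIntegral_eq_and_comp_sqIntegral_eq hp hW
    exact ⟨h1 ▸ he, h2 ▸ hc⟩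

lemma IsQuasiRandom.leftConverges_const {G : ∀ n, SimpleGraph (V n)} {p : ℝ}
    (h : IsQuasiRandom G p) (hV : Tendsto (fun n => Fintype.card (V n)) atTop atTop)
    (hp : p ∈ Set.Icc (0 : ℝ) 1) : LeftConverges G (Graphon.const p hp) := by
  intro s F
  rw [Graphon.homDensity_const]
  exact (isQuasiRandom_iff_tendsto_homDensity G hV p).1 h s F

end Sequence

theorem proposition1 {V : ℕ → Type*} [∀ n, Fintype (V n)] (G : ∀ n, SimpleGraph (V n))
    (hV : Tendsto (fun n => Fintype.card (V n)) atTop atTop)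
    (p : ℝ) (hp : p ∈ Set.Icc (0 : ℝ) 1) :
    -- the equality of the series and the closed form
    (∀ z : ℂ, HasSum (fun k : ℕ => z ^ k * (quasiCoeff p k : ℂ))
      ((1 - p * z) * Complex.exp (p * z - p * (1 - p) / 2 * z ^ 2))) ∧
    -- the characteristic power series of the sequence as the pointwise limit
    (IsQuasiRandom G p ↔
      ∀ z : ℂ, Tendsto (fun n => graphPsi (G n) z) atTop
        (𝓝 (∑' k : ℕ, z ^ k * (quasiCoeff p k : ℂ)))) ∧
    -- the characteristic power series of a graphon, through the regularized determinant
    (IsQuasiRandom G p ↔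
      ∃ W : Graphon, LeftConverges G W ∧
        ∀ z : ℂ, W.charPowerSeries z = ∑' k : ℕ, z ^ k * (quasiCoeff p k : ℂ)) ∧
    (∀ W : Graphon, LeftConverges G W →
      (IsQuasiRandom G p ↔
        ∀ z : ℂ, W.charPowerSeries z = ∑' k : ℕ, z ^ k * (quasiCoeff p k : ℂ))) := by
  simp only [fun z => (hasSum_quasiCoeff p z).tsum_eq]
  refine ⟨hasSum_quasiCoeff p, isQuasiRandom_iff_tendsto_graphPsi G hV hp, ⟨fun h => ?_, ?_⟩,
    fun W hW => hW.isQuasiRandom_iff hV hp⟩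
  · have hlim := h.leftConverges_const hV hp
    exact ⟨_, hlim, (hlim.isQuasiRandom_iff hV hp).1 h⟩
  · rintro ⟨W, hW, hψ⟩
    exact (hW.isQuasiRandom_iff hV hp).2 hψ
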